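/- **Definition.** Let $\mathfrak M$ be a one-dimensional and $\mathfrak N$ a two-dimensional smooth manifold, let $D\subseteq\mathfrak M\times\mathfrak N$, and let $f:D\to\mathbb R$. We say that $f$ gives a phenomenologically symmetric geometry of two sets of rank $(3,2)$ if the following hold. - **A1.** $D$ is open and dense in $\mathfrak M\times\mathfrak N$. - **A2.** $f$ is smooth ($C^\infty$) on $D$. - **A3.** In local coordinates $x$ on $\mathfrak M$ and $(\xi,\eta)$ on $\mathfrak N$, one has $\partial f/\partial x\neq 0$ at every point of $D$; and for any two distinct points $p\ne q$ of $\mathfrak M$ and any $\alpha\in\mathfrak N$ with $(p,\alpha),(q,\alpha)\in D$, the Jacobian $\dfrac{\partial(f(p,\cdot),f(q,\cdot))}{\partial(\xi,\eta)}$ is nonzero at $\alpha$. - **A4.** Call $\langle ijk,\alpha\beta\rangle\in\mathfrak M^3\times\mathfrak N^2$ admissible if $i,j,k$ are pairwise distinct, $\alpha\ne\beta$, and all six pairs lie in $D$. There are an open set $U\subseteq\mathbb R^6$ and a smooth function $\Phi:U\to\mathbb R$ with $d\Phi\neq0$ at every zero of $\Phi$, such that for every admissible $\langle ijk,\alpha\beta\rangle$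 the point $F=(f(i\alpha),f(i\beta),f(j\alpha),f(j\beta),f(k\alpha),f(k\beta))$ lies in $U$ and $\Phi(F)=0$. **Theorem.** (1) If $f$ gives a phenomenologically symmetric geometry of two sets of rank $(3,2)$ on $\mathfrak M$ and $\mathfrak N$, then for every point $(p,\alpha)\in D$ there are a smooth local coordinate $x$ on a neighbourhood $V$ of $p$ in $\mathfrak M$, smooth local coordinates $(\xi,\eta)$ on a neighbourhood $W$ of $\alpha$ in $\mathfrak N$ with $V\times W\subseteq D$, and a diffeomorphism $\chi$ between open subsets of $\mathbb R$ whose domain contains $f(V\times W)$, such that on $V\times W$ $$\chi(f)=x\,\xi+\eta .$$ (2) Conversely, the canonical function $f(x,\xi,\eta)=x\xi+\eta$ on $\mathbb R\times\mathbb R^2$, with domain $D=\{\xi\neq0\}$, gives a phenomenologically symmetric geometry of two sets of rank $(3,2)$. Moreover: - for all $x_i,x_j,x_k$ not all equal and all $(\xi_\alpha,\eta_\alpha),(\xi_\beta,\eta_\beta)$ with $\xi_\alpha\xi_\beta\neq0$, the $7\times6$ matrix of partial derivatives of $f(i\alpha),f(i\beta),f(j\alpha),f(j\beta),f(k\alpha),f(k\beta)$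 with respect to $x_i,x_j,x_k,\xi_\alpha,\eta_\alpha,\xi_\beta,\eta_\beta$ has rank $5$; - A4 holds with $$\Phi=\begin{vmatrix} f(i\alpha)&f(i\beta)&1\\ f(j\alpha)&f(j\beta)&1\\ f(k\alpha)&f(k\beta)&1\end{vmatrix}$$ and with $U$ the open set where $d\Phi\ne0$; - this is the only relation: the set of values of $F$ on the admissible $\langle ijk,\alpha\beta\rangle$ is exactly the set of $(a_i,b_i,a_j,b_j,a_k,b_k)\in\mathbb R^6$ with $\begin{vmatrix} a_i&b_i&1\\ a_j&b_j&1\\ a_k&b_k&1\end{vmatrix}=0$, with $a_i,a_j,a_k$ pairwise distinct, $b_i,b_j,b_k$ pairwise distinct, and $(a_i,a_j,a_k)\neq(b_i,b_j,b_k)$. -/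

import Mathlib

open Set Topology
open scoped Manifold ContDiff

noncomputable section

/-- The coordinate representation `f = f(x, ξ, η)` of a two-point function `f` on `M × N` in a local
coordinate `φ` on `M` and local coordinates `ψ` on `N`. -/
def coordRep {M N : Type*} [TopologicalSpace M] [TopologicalSpace N] (f : M × N → ℝ)
    (φ : OpenPartialHomeomorph M ℝ) (ψ : OpenPartialHomeomorph N (ℝ × ℝ)) : ℝ × (ℝ × ℝ) → ℝ :=
  fun q => f (φ.symm q.1, ψ.symm q.2)

/-- The partial derivative `∂f/∂x` at the point with coordinates `x` and `a = (ξ, η)`. -/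
def partialX (g : ℝ × (ℝ × ℝ) → ℝ) (x : ℝ) (a : ℝ × ℝ) : ℝ :=
  deriv (fun t => g (t, a)) x

/-- The partial derivative `∂f/∂ξ` at the point with coordinates `x` and `a = (ξ, η)`. -/
def partialXi (g : ℝ × (ℝ × ℝ) → ℝ) (x : ℝ) (a : ℝ × ℝ) : ℝ :=
  deriv (fun t => g (x, (t, a.2))) a.1

/-- The partial derivative `∂f/∂η` at the point with coordinates `x` and `a = (ξ, η)`. -/
def partialEta (g : ℝ × (ℝ × ℝ) → ℝ) (x : ℝ) (a : ℝ × ℝ) : ℝ :=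
  deriv (fun t => g (x, (a.1, t))) a.2

/-- The six values of `f` on three points `i, j, k` of `M` and two points `α, β` of `N`; the space
`ℝ⁶` of such sextuples is `Fin 3 → Fin 2 → ℝ`. -/
def sixValues {M N : Type*} (f : M × N → ℝ) (x : Fin 3 → M) (a : Fin 2 → N) :
    Fin 3 → Fin 2 → ℝ :=
  fun r s => f (x r, a s)

/-- `x = (i, j, k)` and `a = (α, β)` form an admissible cortege: `i, j, k` are pairwise distinct,
`α ≠ β`, and the six pairs belong to the domain `D` of the metric function. -/
def IsCortege {M N : Type*} (D : Set (M × N)) (x : Fin 3 → M) (a : Fin 2 → N) : Prop :=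
  Function.Injective x ∧ Function.Injective a ∧ ∀ r s, (x r, a s) ∈ D

/-- The values of `f` on all admissible corteges lie on the smooth nondegenerate hypersurface
`Φ = 0` of the open set `U ⊆ ℝ⁶`: `Φ` is smooth on `U` and its differential vanishes nowhere on
the hypersurface. -/
structure LiesOnHypersurface {M N : Type*} (D : Set (M × N)) (f : M × N → ℝ)
    (U : Set (Fin 3 → Fin 2 → ℝ)) (Φ : (Fin 3 → Fin 2 → ℝ) → ℝ) : Prop where
  isOpen : IsOpen U
  smooth : ContDiffOn ℝ ∞ Φ U
  nondegenerate : ∀ y ∈ U, Φ y = 0 → fderiv ℝ Φ y ≠ 0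
  mem : ∀ x a, IsCortege D x a → sixValues f x a ∈ U
  relation : ∀ x a, IsCortege D x a → Φ (sixValues f x a) = 0

/-- `f`, with domain `D`, gives on the one-dimensional manifold `M` and the two-dimensional
manifold `N` a phenomenologically symmetric geometry of two sets of rank `(3,2)`. Only the values
of `f` on `D` matter. The two inequalities of the third axiom do not depend on the choice
of the local coordinates; the coordinates `φ, φ'` of the points `p, q` may coincide. -/
structure IsPSG2S {M N : Type*} [TopologicalSpace M] [ChartedSpace ℝ M]
    [TopologicalSpace N] [ChartedSpace (ℝ × ℝ) N] (D : Set (M × N)) (f : M × N → ℝ) : Prop where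
  isOpen_domain : IsOpen D
  dense_domain : Dense D
  smooth : ContMDiffOn (𝓘(ℝ, ℝ).prod 𝓘(ℝ, ℝ × ℝ)) 𝓘(ℝ, ℝ) ∞ f D
  essential_x : ∀ φ ∈ atlas ℝ M, ∀ ψ ∈ atlas (ℝ × ℝ) N, ∀ p ∈ φ.source, ∀ α ∈ ψ.source,
    (p, α) ∈ D → partialX (coordRep f φ ψ) (φ p) (ψ α) ≠ 0
  essential_xi_eta : ∀ φ ∈ atlas ℝ M, ∀ φ' ∈ atlas ℝ M, ∀ ψ ∈ atlas (ℝ × ℝ) N,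
    ∀ p ∈ φ.source, ∀ q ∈ φ'.source, ∀ α ∈ ψ.source, p ≠ q → (p, α) ∈ D → (q, α) ∈ D →
      Matrix.det
        !![partialXi (coordRep f φ ψ) (φ p) (ψ α), partialEta (coordRep f φ ψ) (φ p) (ψ α);
           partialXi (coordRep f φ' ψ) (φ' q) (ψ α), partialEta (coordRep f φ' ψ) (φ' q) (ψ α)] ≠ 0
  symmetric : ∃ U Φ, LiesOnHypersurface D f U Φ

/-- The canonical metric function `f = x ξ + η`. -/
def canonicalMetric : ℝ × (ℝ × ℝ) → ℝ := fun q => q.1 * q.2.1 + q.2.2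

/-- The domain `ξ ≠ 0` of the canonical metric function, where `∂f/∂x = ξ` does not vanish. -/
def canonicalDomain : Set (ℝ × (ℝ × ℝ)) := {q | q.2.1 ≠ 0}

/-- The determinant with the rows `(f(iα), f(iβ), 1)`, `(f(jα), f(jβ), 1)`, `(f(kα), f(kβ), 1)`. -/
def canonicalRelation (y : Fin 3 → Fin 2 → ℝ) : ℝ :=
  Matrix.det !![y 0 0, y 0 1, 1; y 1 0, y 1 1, 1; y 2 0, y 2 1, 1]

/-- The functional matrix of the six functions `f(iα), f(iβ), f(jα), f(jβ), f(kα), f(kβ)` (columns)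
with respect to the seven coordinates `x_i, x_j, x_k, ξ_α, η_α, ξ_β, η_β` (rows). -/
def functionalMatrix (f : ℝ × (ℝ × ℝ) → ℝ) (x : Fin 3 → ℝ) (a : Fin 2 → ℝ × ℝ) :
    Matrix (Fin 7) (Fin 6) ℝ :=
  let X := fun r s => partialX f (x r) (a s)
  let K := fun r s => partialXi f (x r) (a s)
  let E := fun r s => partialEta f (x r) (a s)
  !![X 0 0, X 0 1, 0,     0,     0,     0;
     0,     0,     X 1 0, X 1 1, 0,     0;
     0,     0,     0,     0,     X 2 0, X 2 1;
     K 0 0, 0,     K 1 0, 0,     K 2 0, 0;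
     E 0 0, 0,     E 1 0, 0,     E 2 0, 0;
     0,     K 0 1, 0,     K 1 1, 0,     K 2 1;
     0,     E 0 1, 0,     E 1 1, 0,     E 2 1]

end

/-!
In local coordinates write `ω` for the one-form `∇_a f / (∂f/∂x)` in the two variables `a = (ξ, η)`,
depending on `x` as well, so that `df` is proportional to `dx + ω`; the second inequality of the
axioms says that the covectors `ω` at different `x` and the same `a` are independent.

The differential of the relation `Φ` annihilates the differential of the map from corteges to
sextuples of values. The derivatives along the `x r` tie the partial derivatives of `Φ` for `α` to
those for `β`, and the derivatives along `α` and along `β` then say that the covectors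
`ω(x r, α)` satisfy the same linear relation as the covectors `ω(x r, β)`
(`exists_relation_of_hypersurface`). Therefore `ω = c₁(x) A + c₂(x) B`, where the forms `A` and `B`
are the values of `ω` at two fixed points of the line.

The equation `dx + c₁ A + c₂ B ∼ df` is integrable, which means that
`(c₁ c₂' - c₂ c₁') A ∧ B = c₁ dA + c₂ dB` (`wronskian_mul_eq_of_relDeriv_eq`). Hence the Wronskian
`w = c₁ c₂' - c₂ c₁'` equals `k c₁ + l c₂` with constants `k` and `l`, and `dA = k A ∧ B`,
`dB = l A ∧ B`. The constant `k` is the value of `w` at the base point `x₀`, where `c₂` vanishes; it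
is not zero, since otherwise `c₂` would solve a linear homogeneous equation and vanish near `x₀`,
against the independence of the covectors (`eq_zero_of_wronskian_eq_mul`). In the coordinate
`t = c₂ / w` the form `dx + ω` is a multiple of `dt + A + t P` with `P = k B - l A`. Since `dP = 0`
and `dA = A ∧ P`, the Poincaré lemma gives `P = dξ / ξ` and `ξ A = dη`, and `dx + ω` becomes
proportional to `d(t ξ + η)`. So `f` and `t ξ + η` have proportional differentials, and each is
locally a function of the other (`exists_eq_comp_of_fderiv_proportional`).

The statements on the canonical function are computations: two affine functions with nonzero slopes
give three points of the plane on a line, and a line through three given points with different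
abscissas and different ordinates is the graph of such an affine function.
-/

/-! ### The canonical metric function -/

theorem partialX_canonicalMetric (x : ℝ) (a : ℝ × ℝ) : partialX canonicalMetric x a = a.1 := by
  simp [partialX, canonicalMetric]

theorem partialXi_canonicalMetric (x : ℝ) (a : ℝ × ℝ) : partialXi canonicalMetric x a = x := by
  simp [partialXi, canonicalMetric]

theorem partialEta_canonicalMetric (x : ℝ) (a : ℝ × ℝ) : partialEta canonicalMetric x a = 1 := by
  simp [partialEta, canonicalMetric]

theorem canonicalRelation_eq (y : Fin 3 → Fin 2 → ℝ) :
    canonicalRelation y =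
      y 0 0 * (y 1 1 - y 2 1) + y 1 0 * (y 2 1 - y 0 1) + y 2 0 * (y 0 1 - y 1 1) := by
  simp [canonicalRelation, Matrix.det_fin_three]
  ring

theorem contDiff_canonicalRelation : ContDiff ℝ ∞ canonicalRelation := by
  have h : canonicalRelation = fun y : Fin 3 → Fin 2 → ℝ =>
      y 0 0 * (y 1 1 - y 2 1) + y 1 0 * (y 2 1 - y 0 1) + y 2 0 * (y 0 1 - y 1 1) :=
    funext canonicalRelation_eq
  rw [h]
  fun_prop

/-- The differential of the determinant does not vanish where the last two entries of the second
column differ, because these make up the cofactor of the entry `y 0 0`. -/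
theorem fderiv_canonicalRelation_ne_zero {y : Fin 3 → Fin 2 → ℝ} (h : y 1 1 ≠ y 2 1) :
    fderiv ℝ canonicalRelation y ≠ 0 := by
  intro h0
  have hd : HasFDerivAt canonicalRelation (0 : (Fin 3 → Fin 2 → ℝ) →L[ℝ] ℝ) y := by
    rw [← h0]
    exact (contDiff_canonicalRelation.differentiable (by simp) y).hasFDerivAt
  have hc := hd.comp_hasDerivAt_of_eq (0 : ℝ)
    (((hasDerivAt_id (0 : ℝ)).smul_const (Pi.single 0 (Pi.single 0 1) : Fin 3 → Fin 2 → ℝ)).const_add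
      y) (by simp)
  have he : (canonicalRelation ∘ fun t : ℝ =>
      y + id t • (Pi.single 0 (Pi.single 0 1) : Fin 3 → Fin 2 → ℝ)) =
      fun t => t * (y 1 1 - y 2 1) + canonicalRelation y := by
    funext t
    simp [canonicalRelation_eq]
    ring
  rw [he] at hc
  have h2 : HasDerivAt (fun t : ℝ => t * (y 1 1 - y 2 1) + canonicalRelation y)
      (1 * (y 1 1 - y 2 1)) 0 := ((hasDerivAt_id (0 : ℝ)).mul_const _).add_const _
  have h3 := hc.unique h2
  apply h
  have : (0 : ℝ) = y 1 1 - y 2 1 := by simpa using h3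
  linarith

theorem canonicalMetric_injective {a : ℝ × ℝ} (ha : a.1 ≠ 0) :
    Function.Injective fun x => canonicalMetric (x, a) := by
  intro x y h
  simp only [canonicalMetric, add_left_inj] at h
  exact mul_right_cancel₀ ha h

theorem canonicalRelation_sixValues (x : Fin 3 → ℝ) (a : Fin 2 → ℝ × ℝ) :
    canonicalRelation (sixValues canonicalMetric x a) = 0 := by
  simp only [canonicalRelation_eq, sixValues, canonicalMetric]
  ring

theorem liesOnHypersurface_canonical :
    LiesOnHypersurface canonicalDomain canonicalMetric
      {y | fderiv ℝ canonicalRelation y ≠ 0} canonicalRelation where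
  isOpen := isOpen_ne_fun (contDiff_canonicalRelation.continuous_fderiv (by simp)) continuous_const
  smooth := contDiff_canonicalRelation.contDiffOn
  nondegenerate := fun _ hy _ => hy
  mem := by
    rintro x a ⟨hx, -, hD⟩
    refine fderiv_canonicalRelation_ne_zero fun h => ?_
    have := hx (canonicalMetric_injective (hD 1 1) h)
    simp at this
  relation := fun x a _ => canonicalRelation_sixValues x a

theorem isPSG2S_canonical : IsPSG2S canonicalDomain canonicalMetric where
  isOpen_domain := isOpen_ne_fun (by fun_prop) continuous_const
  dense_domain := by
    have h : canonicalDomain = (univ : Set ℝ) ×ˢ (({0}ᶜ : Set ℝ) ×ˢ (univ : Set ℝ)) := by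
      ext q; simp [canonicalDomain]
    rw [h]
    exact dense_univ.prod ((dense_compl_singleton 0).prod dense_univ)
  smooth := by
    have h : ContDiff ℝ ∞ canonicalMetric := by unfold canonicalMetric; fun_prop
    have h2 := h.contMDiff.contMDiffOn (s := canonicalDomain)
    rwa [modelWithCornersSelf_prod, ← chartedSpaceSelf_prod] at h2
  essential_x := by
    rintro φ rfl ψ rfl p - α - hD
    change partialX canonicalMetric p α ≠ 0
    rw [partialX_canonicalMetric]
    exact hD
  essential_xi_eta := by
    rintro φ rfl φ' rfl ψ rfl p - q - α - hpq - -
    change Matrix.det !![partialXi canonicalMetric p α, partialEta canonicalMetric p α;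
      partialXi canonicalMetric q α, partialEta canonicalMetric q α] ≠ 0
    simp [Matrix.det_fin_two, partialXi_canonicalMetric, partialEta_canonicalMetric, sub_eq_zero,
      hpq]
  symmetric := ⟨_, _, liesOnHypersurface_canonical⟩

theorem setOf_sixValues_canonical :
    {y | ∃ x a, IsCortege canonicalDomain x a ∧ y = sixValues canonicalMetric x a} =
      {y | canonicalRelation y = 0 ∧ Function.Injective (fun r => y r 0) ∧
        Function.Injective (fun r => y r 1) ∧ ∃ r, y r 0 ≠ y r 1} := by
  ext y
  constructor
  · rintro ⟨x, a, ⟨hx, ha, hD⟩, rfl⟩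
    refine ⟨canonicalRelation_sixValues x a, (canonicalMetric_injective (hD 0 0)).comp hx,
      (canonicalMetric_injective (hD 0 1)).comp hx, ?_⟩
    -- two affine functions that agree at two distinct points coincide
    by_contra! h
    have h0 := h 0
    have h1 := h 1
    simp only [sixValues, canonicalMetric] at h0 h1
    have hne : x 0 - x 1 ≠ 0 := sub_ne_zero.2 fun h => by simpa using hx h
    have e1 : (a 0).1 = (a 1).1 := mul_left_cancel₀ hne (by linarith)
    have e2 : (a 0).2 = (a 1).2 := by rw [e1] at h0; linarith
    simpa using ha (Prod.ext e1 e2)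
  · rintro ⟨h0, hA, hB, r, hr⟩
    have hA01 : y 1 0 - y 0 0 ≠ 0 := sub_ne_zero.2 fun h => by simpa using hA h
    have hB01 : y 1 1 - y 0 1 ≠ 0 := sub_ne_zero.2 fun h => by simpa using hB h
    -- the affine function through the first two of the points `(y r 0, y r 1)`; the vanishing
    -- determinant puts the third point on its graph
    set m := (y 1 1 - y 0 1) / (y 1 0 - y 0 0) with hm
    have key : ∀ r, y r 1 = y r 0 * m + (y 0 1 - y 0 0 * m) := by
      rw [canonicalRelation_eq] at h0
      intro r
      fin_cases r
      · simp
      · simp only [hm]; field_simp; simp; ring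
      · simp only [hm]; field_simp; simp; linarith
    refine ⟨fun r => y r 0, ![(1, 0), (m, y 0 1 - y 0 0 * m)], ⟨hA, ?_, ?_⟩, ?_⟩
    · intro s s' hs
      by_contra hne
      have : m = 1 ∧ y 0 1 - y 0 0 * m = 0 := by
        fin_cases s <;> fin_cases s'
        · simp at hne
        · simpa [Prod.ext_iff, eq_comm] using hs
        · simpa [Prod.ext_iff] using hs
        · simp at hne
      exact hr (by rw [key r, this.1, ← this.1, this.2, this.1]; ring)
    · intro r s
      fin_cases s
      · simp [canonicalDomain]
      · exact div_ne_zero hB01 hA01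
    · funext r s
      fin_cases s
      · simp [sixValues, canonicalMetric]
      · simpa [sixValues, canonicalMetric] using key r

/-- The columns of the functional matrix satisfy exactly one linear relation, so that its rank is
`6 - 1`. -/
theorem rank_functionalMatrix_canonical (x : Fin 3 → ℝ) (a : Fin 2 → ℝ × ℝ)
    (hx : ∃ r r', x r ≠ x r') (ha : ∀ s, (a s).1 ≠ 0) :
    (functionalMatrix canonicalMetric x a).rank = 5 := by
  have h0 := ha 0
  have h1 := ha 1
  set A := functionalMatrix canonicalMetric x a with hA
  have hmul : ∀ v : Fin 6 → ℝ, A.mulVec v = 0 ↔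
      (a 0).1 * v 0 + (a 1).1 * v 1 = 0 ∧ (a 0).1 * v 2 + (a 1).1 * v 3 = 0 ∧
      (a 0).1 * v 4 + (a 1).1 * v 5 = 0 ∧ x 0 * v 0 + x 1 * v 2 + x 2 * v 4 = 0 ∧
      v 0 + v 2 + v 4 = 0 ∧ x 0 * v 1 + x 1 * v 3 + x 2 * v 5 = 0 ∧ v 1 + v 3 + v 5 = 0 := by
    intro v
    simp [hA, functionalMatrix, partialX_canonicalMetric, partialXi_canonicalMetric,
      partialEta_canonicalMetric, funext_iff, Fin.forall_fin_succ, dotProduct,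
      Fin.sum_univ_succ, add_assoc]
  have hker : Module.finrank ℝ (LinearMap.ker A.mulVecLin) = 1 := by
    -- the three coefficients of the relation at each of the points `α`, `β` are proportional to
    -- the differences of the `x r`
    let w : Fin 6 → ℝ := ![(a 1).1 * (x 1 - x 2), -((a 0).1 * (x 1 - x 2)),
      (a 1).1 * (x 2 - x 0), -((a 0).1 * (x 2 - x 0)),
      (a 1).1 * (x 0 - x 1), -((a 0).1 * (x 0 - x 1))]
    have hw : A.mulVec w = 0 := by
      rw [hmul]
      simp only [w]
      simp
      refine ⟨by ring, by ring, by ring, by ring, by ring, by ring, by ring⟩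
    refine finrank_eq_one_iff'.2 ⟨⟨w, hw⟩, ?_, ?_⟩
    · intro h
      have hw0 : w = 0 := congrArg Subtype.val h
      have e0 : x 1 = x 2 := by simpa [w, h1, sub_eq_zero] using congrFun hw0 0
      have e1 : x 2 = x 0 := by simpa [w, h1, sub_eq_zero] using congrFun hw0 2
      obtain ⟨r, r', hr⟩ := hx
      apply hr
      fin_cases r <;> fin_cases r' <;> simp [e0, e1]
    · rintro ⟨v, hv⟩
      obtain ⟨k1, k2, k3, k4, k5, -, -⟩ := (hmul v).1 hv
      have hd : (x 1 - x 2) ^ 2 + (x 2 - x 0) ^ 2 + (x 0 - x 1) ^ 2 ≠ 0 := by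
        intro hs
        have e0 : x 1 - x 2 = 0 := by nlinarith [sq_nonneg (x 2 - x 0), sq_nonneg (x 0 - x 1)]
        have e1 : x 2 - x 0 = 0 := by nlinarith [sq_nonneg (x 1 - x 2), sq_nonneg (x 0 - x 1)]
        obtain ⟨r, r', hr⟩ := hx
        apply hr
        fin_cases r <;> fin_cases r' <;> simp <;> linarith
      -- the coefficient of the orthogonal projection of `(v 0, v 2, v 4)` to the vector of differences
      let c := (v 0 * (x 1 - x 2) + v 2 * (x 2 - x 0) + v 4 * (x 0 - x 1)) /
        ((x 1 - x 2) ^ 2 + (x 2 - x 0) ^ 2 + (x 0 - x 1) ^ 2)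
      have c0 : v 0 = c * (x 1 - x 2) := by
        simp only [c]; field_simp
        linear_combination (2 * x 0 - x 1 - x 2) * k4 +
          (x 1 ^ 2 + x 2 ^ 2 - x 0 * x 1 - x 0 * x 2) * k5
      have c2 : v 2 = c * (x 2 - x 0) := by
        simp only [c]; field_simp
        linear_combination (2 * x 1 - x 2 - x 0) * k4 +
          (x 2 ^ 2 + x 0 ^ 2 - x 1 * x 2 - x 1 * x 0) * k5
      have c4 : v 4 = c * (x 0 - x 1) := by linear_combination k5 - c0 - c2
      have e1 : v 1 = -((a 0).1 * v 0) / (a 1).1 := by field_simp; linear_combination k1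
      have e3 : v 3 = -((a 0).1 * v 2) / (a 1).1 := by field_simp; linear_combination k2
      have e5 : v 5 = -((a 0).1 * v 4) / (a 1).1 := by field_simp; linear_combination k3
      refine ⟨c / (a 1).1, Subtype.ext (funext fun i => ?_)⟩
      change c / (a 1).1 * w i = v i
      fin_cases i <;> simp [w]
      · rw [c0]; field_simp
      · rw [e1, c0]; field_simp
      · rw [c2]; field_simp
      · rw [e3, c2]; field_simp
      · rw [c4]; field_simp
      · rw [e5, c4]; field_simp
  have := LinearMap.finrank_range_add_finrank_ker A.mulVecLin
  rw [hker] at this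
  simp at this
  simpa [Matrix.rank] using this

/-! ### Inverse functions and functional dependence -/

theorem ContinuousLinearMap.isInvertible_of_injective {E : Type*} [NormedAddCommGroup E]
    [NormedSpace ℝ E] [FiniteDimensional ℝ E] {L : E →L[ℝ] E} (hL : ∀ v, L v = 0 → v = 0) :
    L.IsInvertible := by
  have hinj : Function.Injective (L : E →ₗ[ℝ] E) := (injective_iff_map_eq_zero _).2 hL
  exact ⟨(LinearEquiv.ofInjectiveEndo (L : E →ₗ[ℝ] E) hinj).toContinuousLinearEquiv,
    ContinuousLinearMap.ext fun v => rfl⟩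

/-- The smooth inverse function theorem, with a local inverse that is smooth on its whole domain. -/
theorem ContDiffOn.exists_openPartialHomeomorph {E F : Type*} [NormedAddCommGroup E]
    [NormedSpace ℝ E] [CompleteSpace E] [NormedAddCommGroup F] [NormedSpace ℝ F]
    {h : E → F} {U : Set E} (hU : IsOpen U) (hh : ContDiffOn ℝ ∞ h U) {x₀ : E} (hx₀ : x₀ ∈ U)
    (hinv : (fderiv ℝ h x₀).IsInvertible) :
    ∃ e : OpenPartialHomeomorph E F, (e : E → F) = h ∧ x₀ ∈ e.source ∧ e.source ⊆ U ∧
      ContDiffOn ℝ ∞ e e.source ∧ ContDiffOn ℝ ∞ e.symm e.target := by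
  have hat : ∀ x ∈ U, ContDiffAt ℝ ∞ h x := fun x hx => hh.contDiffAt (hU.mem_nhds hx)
  obtain ⟨L, hL⟩ := hinv
  have hd : HasFDerivAt h (L : E →L[ℝ] F) x₀ := by
    rw [hL]; exact ((hat x₀ hx₀).differentiableAt (by simp)).hasFDerivAt
  let e₀ := (hat x₀ hx₀).toOpenPartialHomeomorph h hd (by simp)
  have hcont : ContinuousOn (fderiv ℝ h) U := hh.continuousOn_fderiv_of_isOpen hU (by simp)
  let S : Set E := U ∩ fderiv ℝ h ⁻¹' range ((↑) : (E ≃L[ℝ] F) → E →L[ℝ] F)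
  have hS : IsOpen S := hcont.isOpen_inter_preimage hU (ContinuousLinearEquiv.isOpen (𝕜 := ℝ))
  have hx₀S : x₀ ∈ S := ⟨hx₀, L, hL⟩
  refine ⟨e₀.restrOpen S hS, rfl, ⟨ContDiffAt.mem_toOpenPartialHomeomorph_source _ hd _, hx₀S⟩,
    fun x hx => hx.2.1, hh.mono fun x hx => hx.2.1, ?_⟩
  intro y hy
  have hy' := (e₀.restrOpen S hS).map_target hy
  obtain ⟨hyU, L', hL'⟩ := hy'.2
  refine (OpenPartialHomeomorph.contDiffAt_symm _ hy (f₀' := L') ?_ (hat _ hyU)).contDiffWithinAt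
  rw [hL']
  exact ((hat _ hyU).differentiableAt (by simp)).hasFDerivAt

theorem ContDiffOn.exists_openPartialHomeomorph_real {h : ℝ → ℝ} {U : Set ℝ} (hU : IsOpen U)
    (hh : ContDiffOn ℝ ∞ h U) {x₀ : ℝ} (hx₀ : x₀ ∈ U) (hd : deriv h x₀ ≠ 0) :
    ∃ e : OpenPartialHomeomorph ℝ ℝ, (e : ℝ → ℝ) = h ∧ x₀ ∈ e.source ∧ e.source ⊆ U ∧
      ContDiffOn ℝ ∞ e e.source ∧ ContDiffOn ℝ ∞ e.symm e.target := by
  refine hh.exists_openPartialHomeomorph hU hx₀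
    (ContinuousLinearMap.isInvertible_of_injective fun v hv => ?_)
  rw [fderiv_eq_smul_deriv] at hv
  simpa [hd] using hv

/-- If `∂f/∂x ≠ 0` and the differentials of `f` and `F` are proportional, then `F` is locally a
function of `f`. In the coordinates `(f, a)` the function `F` has vanishing derivative along
`a`. -/
theorem exists_eq_comp_of_fderiv_proportional {V : Type*} [NormedAddCommGroup V] [NormedSpace ℝ V]
    [FiniteDimensional ℝ V] {f F : ℝ × V → ℝ} {U : Set (ℝ × V)} (hU : IsOpen U)
    (hf : ContDiffOn ℝ ∞ f U) (hF : ContDiffOn ℝ ∞ F U)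
    (hfx : ∀ q ∈ U, fderiv ℝ f q (1, 0) ≠ 0)
    (hprop : ∀ q ∈ U, ∀ v : V, fderiv ℝ F q (0, v) * fderiv ℝ f q (1, 0) =
      fderiv ℝ F q (1, 0) * fderiv ℝ f q (0, v))
    {q₀ : ℝ × V} (hq₀ : q₀ ∈ U) (hFx : fderiv ℝ F q₀ (1, 0) ≠ 0) :
    ∃ χ : OpenPartialHomeomorph ℝ ℝ, ContDiffOn ℝ ∞ χ χ.source ∧ ContDiffOn ℝ ∞ χ.symm χ.target ∧
      ∀ᶠ q in 𝓝 q₀, f q ∈ χ.source ∧ χ (f q) = F q := by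
  have hsplit : ∀ (L : ℝ × V →L[ℝ] ℝ) (w : ℝ × V), L w = w.1 * L (1, 0) + L (0, w.2) := by
    intro L w
    have : w = w.1 • ((1, 0) : ℝ × V) + (0, w.2) := by ext <;> simp
    conv_lhs => rw [this, map_add, map_smul, smul_eq_mul]
  have hfd : ∀ q ∈ U, HasFDerivAt f (fderiv ℝ f q) q := fun q hq =>
    ((hf.contDiffAt (hU.mem_nhds hq)).differentiableAt (by simp)).hasFDerivAt
  have hFd : ∀ q ∈ U, HasFDerivAt F (fderiv ℝ F q) q := fun q hq =>
    ((hF.contDiffAt (hU.mem_nhds hq)).differentiableAt (by simp)).hasFDerivAt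
  let Ψ : ℝ × V → ℝ × V := fun q => (f q, q.2)
  have hΨd : ∀ q ∈ U, HasFDerivAt Ψ ((fderiv ℝ f q).prod (ContinuousLinearMap.snd ℝ ℝ V)) q :=
    fun q hq => (hfd q hq).prodMk hasFDerivAt_snd
  have hΨ : ContDiffOn ℝ ∞ Ψ U := hf.prodMk contDiffOn_snd
  have hinv : ∀ q ∈ U, (fderiv ℝ Ψ q).IsInvertible := by
    intro q hq
    rw [(hΨd q hq).fderiv]
    refine ContinuousLinearMap.isInvertible_of_injective fun w hw => ?_
    have h1 : fderiv ℝ f q w = 0 := congrArg Prod.fst hw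
    have h2 : w.2 = 0 := congrArg Prod.snd hw
    rw [hsplit, h2, Prod.mk_zero_zero, map_zero, add_zero] at h1
    refine Prod.ext ?_ h2
    exact (mul_eq_zero.1 h1).resolve_right (hfx q hq)
  obtain ⟨e, he, hq₀e, heU, -, hes⟩ := hΨ.exists_openPartialHomeomorph hU hq₀ (hinv q₀ hq₀)
  obtain ⟨ε, hε, hball⟩ := Metric.isOpen_iff.1 e.open_target (Ψ q₀)
    (by have := e.map_source hq₀e; rwa [he] at this)
  rw [← ball_prod_same] at hball
  have hsymm : ∀ y ∈ e.target, e.symm y ∈ U := fun y hy => heU (e.map_target hy)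
  have hsd : ∀ y ∈ e.target, HasFDerivAt e.symm (fderiv ℝ e.symm y) y := fun y hy =>
    ((hes.contDiffAt (e.open_target.mem_nhds hy)).differentiableAt (by simp)).hasFDerivAt
  -- along the fibres of `f` the function `F` is constant
  have hconst : ∀ s ∈ Metric.ball (f q₀) ε, ∀ a ∈ Metric.ball q₀.2 ε,
      F (e.symm (s, a)) = F (e.symm (s, q₀.2)) := by
    intro s hs a ha
    have hder : ∀ b ∈ Metric.ball q₀.2 ε,
        HasFDerivAt (fun b => F (e.symm (s, b))) (0 : V →L[ℝ] ℝ) b := by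
      intro b hb
      have hy : (s, b) ∈ e.target := hball ⟨hs, hb⟩
      have h1 := (hFd _ (hsymm _ hy)).comp b ((hsd _ hy).comp b (hasFDerivAt_prodMk_right s b))
      refine h1.congr_fderiv (ContinuousLinearMap.ext fun v => ?_)
      set w : ℝ × V := fderiv ℝ e.symm (s, b) (0, v) with hw
      have h2 : HasFDerivAt (fun y => Ψ (e.symm y)) (ContinuousLinearMap.id ℝ (ℝ × V)) (s, b) := by
        refine (hasFDerivAt_id _).congr_of_eventuallyEq ?_
        filter_upwards [e.open_target.mem_nhds hy] with y hy
        rw [← he]; exact e.right_inv hy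
      have h3 := h2.unique ((hΨd _ (hsymm _ hy)).comp _ (hsd _ hy))
      have h4 : ((0, v) : ℝ × V) = (fderiv ℝ f (e.symm (s, b)) w, w.2) :=
        congrArg (fun L : ℝ × V →L[ℝ] ℝ × V => L (0, v)) h3
      have h5 : fderiv ℝ f (e.symm (s, b)) w = 0 := (congrArg Prod.fst h4).symm
      have hgoal : fderiv ℝ F (e.symm (s, b)) w = 0 := by
        refine (mul_eq_zero.1 ?_).resolve_right (hfx _ (hsymm _ hy))
        rw [hsplit] at h5 ⊢
        linear_combination (fderiv ℝ F (e.symm (s, b)) (1, 0)) * h5 +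
          hprop _ (hsymm _ hy) w.2
      simpa [hw] using hgoal
    refine (convex_ball q₀.2 ε).is_const_of_fderivWithin_eq_zero (𝕜 := ℝ)
      (fun b hb => (hder b hb).differentiableAt.differentiableWithinAt) (fun b hb => ?_) ha
      (Metric.mem_ball_self hε)
    rw [fderivWithin_of_isOpen Metric.isOpen_ball hb, (hder b hb).fderiv]
  let χ₀ : ℝ → ℝ := fun s => F (e.symm (s, q₀.2))
  have hχ₀ : ContDiffOn ℝ ∞ χ₀ (Metric.ball (f q₀) ε) := by
    refine hF.comp (hes.comp (by fun_prop) fun s hs => hball ⟨hs, Metric.mem_ball_self hε⟩) ?_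
    exact fun s hs => hsymm _ (hball ⟨hs, Metric.mem_ball_self hε⟩)
  have hnear : ∀ᶠ q in 𝓝 q₀, f q ∈ Metric.ball (f q₀) ε ∧ χ₀ (f q) = F q := by
    have hfc : ContinuousAt f q₀ := (hfd q₀ hq₀).continuousAt
    filter_upwards [e.open_source.mem_nhds hq₀e, hfc (Metric.ball_mem_nhds _ hε),
      continuousAt_snd (Metric.ball_mem_nhds q₀.2 hε)] with q h1 h2 h3
    refine ⟨h2, ?_⟩
    have h4 : e.symm (f q, q.2) = q := by
      have := e.left_inv h1
      rwa [he] at this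
    change F (e.symm (f q, q₀.2)) = F q
    rw [← hconst _ h2 _ h3, h4]
  have hχd : deriv χ₀ (f q₀) ≠ 0 := by
    intro h0
    have h1 : HasDerivAt χ₀ 0 (f q₀) := by
      rw [← h0]
      exact ((hχ₀.contDiffAt (Metric.ball_mem_nhds _ hε)).differentiableAt (by simp)).hasDerivAt
    have h2 := (h1.comp_hasFDerivAt q₀ (hfd q₀ hq₀)).congr_of_eventuallyEq
      (f₁ := F) (hnear.mono fun q hq => hq.2.symm)
    exact hFx (by rw [h2.fderiv]; simp)
  obtain ⟨χ, hχ, hmem, -, hs1, hs2⟩ := hχ₀.exists_openPartialHomeomorph_real Metric.isOpen_ball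
    (Metric.mem_ball_self hε) hχd
  refine ⟨χ, hs1, hs2, ?_⟩
  filter_upwards [hnear, (hfd q₀ hq₀).continuousAt (χ.open_source.mem_nhds hmem)] with q h1 h2
  exact ⟨h2, by rw [hχ]; exact h1.2⟩

/-! ### The Pfaffian equation of a function of a line and a plane variable -/

/-- The derivative of `f` in the direction `v` of the second factor, relative to `∂f/∂x`; in other
words, the value on `v` of the part `ω` of the form `dx + ω` that is proportional to `df`. -/
noncomputable def relDeriv {V : Type*} [NormedAddCommGroup V] [NormedSpace ℝ V] (f : ℝ × V → ℝ)
    (v : V) (q : ℝ × V) : ℝ :=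
  fderiv ℝ f q (0, v) / fderiv ℝ f q (1, 0)

/-- The integrability condition of the Pfaffian equation `df = (∂f/∂x) (dx + ω)`, which comes from
the symmetry of the second derivatives of `f`. -/
theorem relDeriv_integrability {V : Type*} [NormedAddCommGroup V] [NormedSpace ℝ V]
    {f : ℝ × V → ℝ} {q : ℝ × V} (hf : ContDiffAt ℝ ∞ f q) (hx : fderiv ℝ f q (1, 0) ≠ 0) (v w : V) :
    relDeriv f v q * fderiv ℝ (relDeriv f w) q (1, 0) -
        relDeriv f w q * fderiv ℝ (relDeriv f v) q (1, 0) =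
      fderiv ℝ (relDeriv f w) q (0, v) - fderiv ℝ (relDeriv f v) q (0, w) := by
  have hsymm := hf.isSymmSndFDerivAt (by simpa using WithTop.coe_le_coe.2 (le_top : (2 : ℕ∞) ≤ ⊤))
  have hd : HasFDerivAt (fderiv ℝ f) (fderiv ℝ (fderiv ℝ f) q) q :=
    ((hf.fderiv_right (m := ∞) (by simp)).differentiableAt (by simp)).hasFDerivAt
  have happ : ∀ u : ℝ × V, HasFDerivAt (fun p => fderiv ℝ f p u)
      ((fderiv ℝ (fderiv ℝ f) q).flip u) q := fun u => by
    simpa using hd.clm_apply (hasFDerivAt_const u q)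
  have hrel : ∀ u : V, ∀ z : ℝ × V, fderiv ℝ (relDeriv f u) q z =
      (fderiv ℝ (fderiv ℝ f) q z (0, u) * fderiv ℝ f q (1, 0) -
        fderiv ℝ f q (0, u) * fderiv ℝ (fderiv ℝ f) q z (1, 0)) / fderiv ℝ f q (1, 0) ^ 2 := by
    intro u z
    have h := (happ (0, u)).mul ((hasDerivAt_inv hx).comp_hasFDerivAt q (happ (1, 0)))
    have h' : fderiv ℝ (relDeriv f u) q = _ := h.fderiv
    rw [h']
    simp
    field_simp
    ring
  simp only [hrel, relDeriv]
  rw [hsymm (0, v) (0, w), hsymm (0, v) (1, 0), hsymm (0, w) (1, 0)]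
  field_simp
  ring

theorem contDiffOn_relDeriv {V : Type*} [NormedAddCommGroup V] [NormedSpace ℝ V]
    {f : ℝ × V → ℝ} {U : Set (ℝ × V)} (hU : IsOpen U) (hf : ContDiffOn ℝ ∞ f U)
    (hx : ∀ q ∈ U, fderiv ℝ f q (1, 0) ≠ 0) (v : V) : ContDiffOn ℝ ∞ (relDeriv f v) U := by
  have h := hf.fderiv_of_isOpen hU (m := ∞) (by simp)
  exact (h.clm_apply contDiffOn_const).div (h.clm_apply contDiffOn_const) hx

/-- The coefficient of the exterior derivative of the one-form `A₁ dξ + A₂ dη` on the plane. -/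
noncomputable def planarCurl (A₁ A₂ : ℝ × ℝ → ℝ) (a : ℝ × ℝ) : ℝ :=
  fderiv ℝ A₂ a (1, 0) - fderiv ℝ A₁ a (0, 1)

theorem ContinuousLinearMap.apply_eq_planar (L : ℝ × ℝ →L[ℝ] ℝ) (v : ℝ × ℝ) :
    L v = v.1 * L (1, 0) + v.2 * L (0, 1) := by
  have : v = v.1 • ((1, 0) : ℝ × ℝ) + v.2 • ((0, 1) : ℝ × ℝ) := by ext <;> simp
  conv_lhs => rw [this, map_add, map_smul, map_smul, smul_eq_mul, smul_eq_mul]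

/-- The Poincaré lemma for smooth one-forms on a convex open set of the plane. -/
theorem exists_potential_of_planarCurl_eq_zero {W : Set (ℝ × ℝ)} (hW : IsOpen W)
    (hc : Convex ℝ W) {A₁ A₂ : ℝ × ℝ → ℝ} (h₁ : ContDiffOn ℝ ∞ A₁ W) (h₂ : ContDiffOn ℝ ∞ A₂ W)
    (hcurl : ∀ a ∈ W, planarCurl A₁ A₂ a = 0) :
    ∃ u : ℝ × ℝ → ℝ, ContDiffOn ℝ ∞ u W ∧
      ∀ a ∈ W, fderiv ℝ u a (1, 0) = A₁ a ∧ fderiv ℝ u a (0, 1) = A₂ a := by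
  let θ : ℝ × ℝ → ℝ × ℝ →L[ℝ] ℝ := fun a =>
    A₁ a • ContinuousLinearMap.fst ℝ ℝ ℝ + A₂ a • ContinuousLinearMap.snd ℝ ℝ ℝ
  have hθ : ContDiffOn ℝ ∞ θ W := (h₁.smul contDiffOn_const).add (h₂.smul contDiffOn_const)
  have hd : ∀ {A : ℝ × ℝ → ℝ}, ContDiffOn ℝ ∞ A W → ∀ a ∈ W, HasFDerivAt A (fderiv ℝ A a) a :=
    fun h a ha => ((h.contDiffAt (hW.mem_nhds ha)).differentiableAt (by simp)).hasFDerivAt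
  obtain ⟨u, hu⟩ := hc.exists_forall_hasFDerivAt_of_fderiv_symmetric hW
    (hθ.differentiableOn (by simp)) (fun a ha x y => by
      have h := ((hd h₁ a ha).smul_const (ContinuousLinearMap.fst ℝ ℝ ℝ)).add
        ((hd h₂ a ha).smul_const (ContinuousLinearMap.snd ℝ ℝ ℝ))
      have h' : fderiv ℝ θ a = _ := h.fderiv
      have hz := hcurl a ha
      rw [planarCurl] at hz
      rw [h']
      simp only [add_apply, ContinuousLinearMap.smulRight_apply,
        smul_apply, ContinuousLinearMap.coe_fst', ContinuousLinearMap.coe_snd',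
        smul_eq_mul]
      rw [(fderiv ℝ A₁ a).apply_eq_planar x, (fderiv ℝ A₂ a).apply_eq_planar x,
        (fderiv ℝ A₁ a).apply_eq_planar y, (fderiv ℝ A₂ a).apply_eq_planar y]
      linear_combination (x.1 * y.2 - x.2 * y.1) * hz)
  refine ⟨u, ?_, fun a ha => ?_⟩
  · rw [contDiffOn_infty_iff_fderiv_of_isOpen hW]
    exact ⟨fun a ha => (hu a ha).differentiableAt.differentiableWithinAt,
      hθ.congr fun a ha => (hu a ha).fderiv⟩
  · rw [(hu a ha).fderiv]
    simp [θ]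

/-- If the form `ω` with `df ∼ dx + ω` splits as `c₁(x) A + c₂(x) B`, then its integrability
condition links the Wronskian of the coefficients to the exterior derivatives of `A` and `B`. -/
theorem wronskian_mul_eq_of_relDeriv_eq {f : ℝ × (ℝ × ℝ) → ℝ} {I : Set ℝ} {W : Set (ℝ × ℝ)}
    (hI : IsOpen I) (hW : IsOpen W) (hf : ContDiffOn ℝ ∞ f (I ×ˢ W))
    (hx : ∀ q ∈ I ×ˢ W, fderiv ℝ f q (1, 0) ≠ 0)
    {c₁ c₂ : ℝ → ℝ} {A₁ A₂ B₁ B₂ : ℝ × ℝ → ℝ}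
    (hc₁ : ContDiffOn ℝ ∞ c₁ I) (hc₂ : ContDiffOn ℝ ∞ c₂ I)
    (hA₁ : ContDiffOn ℝ ∞ A₁ W) (hA₂ : ContDiffOn ℝ ∞ A₂ W)
    (hB₁ : ContDiffOn ℝ ∞ B₁ W) (hB₂ : ContDiffOn ℝ ∞ B₂ W)
    (h₁ : ∀ x ∈ I, ∀ a ∈ W, relDeriv f (1, 0) (x, a) = c₁ x * A₁ a + c₂ x * B₁ a)
    (h₂ : ∀ x ∈ I, ∀ a ∈ W, relDeriv f (0, 1) (x, a) = c₁ x * A₂ a + c₂ x * B₂ a)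
    {x : ℝ} (hxI : x ∈ I) {a : ℝ × ℝ} (haW : a ∈ W) :
    (c₁ x * deriv c₂ x - c₂ x * deriv c₁ x) * (A₁ a * B₂ a - A₂ a * B₁ a) =
      c₁ x * planarCurl A₁ A₂ a + c₂ x * planarCurl B₁ B₂ a := by
  have hq : (x, a) ∈ I ×ˢ W := ⟨hxI, haW⟩
  have hU : I ×ˢ W ∈ 𝓝 (x, a) := (hI.prod hW).mem_nhds hq
  have hcd : ∀ {c : ℝ → ℝ}, ContDiffOn ℝ ∞ c I → HasDerivAt c (deriv c x) x := fun h =>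
    ((h.contDiffAt (hI.mem_nhds hxI)).differentiableAt (by simp)).hasDerivAt
  have hAd : ∀ {A : ℝ × ℝ → ℝ}, ContDiffOn ℝ ∞ A W → HasFDerivAt A (fderiv ℝ A a) a := fun h =>
    ((h.contDiffAt (hW.mem_nhds haW)).differentiableAt (by simp)).hasFDerivAt
  have key : ∀ {v : ℝ × ℝ} {A B : ℝ × ℝ → ℝ}, ContDiffOn ℝ ∞ A W → ContDiffOn ℝ ∞ B W →
      (∀ x ∈ I, ∀ a ∈ W, relDeriv f v (x, a) = c₁ x * A a + c₂ x * B a) → ∀ s u,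
      fderiv ℝ (relDeriv f v) (x, a) (s, u) = s * (deriv c₁ x * A a + deriv c₂ x * B a) +
        (c₁ x * fderiv ℝ A a u + c₂ x * fderiv ℝ B a u) := by
    intro v A B hA hB h s u
    have h1 := (hcd hc₁).comp_hasFDerivAt (x, a) (hasFDerivAt_fst (𝕜 := ℝ) (p := (x, a)))
    have h2 := (hcd hc₂).comp_hasFDerivAt (x, a) (hasFDerivAt_fst (𝕜 := ℝ) (p := (x, a)))
    have h3 := (hAd hA).comp (x, a) (hasFDerivAt_snd (𝕜 := ℝ) (p := (x, a)))
    have h4 := (hAd hB).comp (x, a) (hasFDerivAt_snd (𝕜 := ℝ) (p := (x, a)))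
    have h5 := ((h1.mul h3).add (h2.mul h4)).congr_of_eventuallyEq (f₁ := relDeriv f v) (by
      filter_upwards [hU] with q hq
      exact h q.1 hq.1 q.2 hq.2)
    rw [h5.fderiv]
    simp
    ring
  have hint := relDeriv_integrability (hf.contDiffAt hU) (hx _ hq) (1, 0) (0, 1)
  rw [key hA₁ hB₁ h₁, key hA₂ hB₂ h₂, key hA₁ hB₁ h₁, key hA₂ hB₂ h₂, h₁ x hxI a haW,
    h₂ x hxI a haW] at hint
  have e0 : ∀ L : ℝ × ℝ →L[ℝ] ℝ, L 0 = 0 := fun L => map_zero L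
  simp only [e0] at hint
  rw [planarCurl, planarCurl]
  linear_combination hint

/-- A solution of a linear homogeneous equation `c₁ c₂' - c₂ c₁' = κ c₂` with `c₁ ≠ 0` and a zero
vanishes to the right of this zero. -/
theorem eq_zero_of_wronskian_eq_mul {c₁ c₂ : ℝ → ℝ} {I : Set ℝ} (hI : IsOpen I)
    (hc₁ : ContDiffOn ℝ ∞ c₁ I) (hc₂ : ContDiffOn ℝ ∞ c₂ I) {x₀ κ : ℝ} (hx₀ : x₀ ∈ I)
    (h₁ : c₁ x₀ ≠ 0) (h₂ : c₂ x₀ = 0)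
    (hW : ∀ x ∈ I, c₁ x * deriv c₂ x - c₂ x * deriv c₁ x = κ * c₂ x) :
    ∃ x ∈ I, x₀ < x ∧ c₂ x = 0 := by
  have hS : IsOpen (I ∩ c₁ ⁻¹' {0}ᶜ) :=
    hc₁.continuousOn.isOpen_inter_preimage hI isOpen_compl_singleton
  obtain ⟨ε, hε, hball⟩ := Metric.isOpen_iff.1 hS x₀ ⟨hx₀, h₁⟩
  have hsub : Icc x₀ (x₀ + ε / 2) ⊆ I ∩ c₁ ⁻¹' {0}ᶜ := fun x hx => hball (by
    rw [Metric.mem_ball, Real.dist_eq, abs_lt]; constructor <;> linarith [hx.1, hx.2])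
  have hderiv : ContinuousOn (deriv c₁) I := hc₁.continuousOn_deriv_of_isOpen hI (by simp)
  obtain ⟨K, hK⟩ := isCompact_Icc.exists_bound_of_continuousOn
    (f := fun x => (κ + deriv c₁ x) / c₁ x) (s := Icc x₀ (x₀ + ε / 2))
    ((continuousOn_const.add (hderiv.mono fun x hx => (hsub hx).1)).div
      (hc₁.continuousOn.mono fun x hx => (hsub hx).1) fun x hx => (hsub hx).2)
  have hd : ∀ x ∈ I, HasDerivAt c₂ (deriv c₂ x) x := fun x hx =>
    ((hc₂.contDiffAt (hI.mem_nhds hx)).differentiableAt (by simp)).hasDerivAt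
  have hzero := eq_zero_of_abs_deriv_le_mul_abs_self_of_eq_zero_right (K := K)
    (hc₂.continuousOn.mono fun x hx => (hsub hx).1)
    (fun x hx => (hd x (hsub (Ico_subset_Icc_self hx)).1).hasDerivWithinAt) h₂ (fun x hx => by
      obtain ⟨hxI, hx1⟩ := hsub (Ico_subset_Icc_self hx)
      have hx1 : c₁ x ≠ 0 := hx1
      have : deriv c₂ x = (κ + deriv c₁ x) / c₁ x * c₂ x := by
        field_simp; linear_combination hW x hxI
      rw [this, norm_mul]
      exact mul_le_mul_of_nonneg_right (hK x (Ico_subset_Icc_self hx)) (norm_nonneg _))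
  have hmem : x₀ + ε / 2 ∈ Icc x₀ (x₀ + ε / 2) := ⟨by linarith, le_rfl⟩
  exact ⟨x₀ + ε / 2, (hsub hmem).1, by linarith, hzero _ hmem⟩

/-! ### The normal form in coordinates -/

/-- Around the point `(x₀, a₀)` and inside the box `I ×ˢ W` there are smooth local coordinates `T` on
the line and `E` on the plane and a diffeomorphism `χ` of open sets of the line that bring `f` to
the form `χ (f (x, a)) = T x * ξ + η`, where `E a = (ξ, η)`. -/
def HasNormalFormNear (f : ℝ × (ℝ × ℝ) → ℝ) (I : Set ℝ) (W : Set (ℝ × ℝ)) (x₀ : ℝ) (a₀ : ℝ × ℝ) :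
    Prop :=
  ∃ (T : OpenPartialHomeomorph ℝ ℝ) (E : OpenPartialHomeomorph (ℝ × ℝ) (ℝ × ℝ))
    (χ : OpenPartialHomeomorph ℝ ℝ),
    (ContDiffOn ℝ ∞ T T.source ∧ ContDiffOn ℝ ∞ T.symm T.target) ∧
    (ContDiffOn ℝ ∞ E E.source ∧ ContDiffOn ℝ ∞ E.symm E.target) ∧
    (ContDiffOn ℝ ∞ χ χ.source ∧ ContDiffOn ℝ ∞ χ.symm χ.target) ∧
    x₀ ∈ T.source ∧ a₀ ∈ E.source ∧
    ∀ x ∈ T.source, ∀ a ∈ E.source, x ∈ I ∧ a ∈ W ∧ f (x, a) ∈ χ.source ∧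
      χ (f (x, a)) = T x * (E a).1 + (E a).2

/-- If the form `ω` with `df ∼ dx + ω` splits as `c₁(x) A + c₂(x) B` with independent `A` and `B`,
then `f` is locally a function of `t(x) ξ + η` in suitable coordinates. -/
theorem exists_normalForm_of_relDeriv_eq {f : ℝ × (ℝ × ℝ) → ℝ} {I : Set ℝ} {W : Set (ℝ × ℝ)}
    (hI : IsOpen I) (hW : IsOpen W) (hWc : Convex ℝ W) (hf : ContDiffOn ℝ ∞ f (I ×ˢ W))
    (hx : ∀ q ∈ I ×ˢ W, fderiv ℝ f q (1, 0) ≠ 0)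
    {c₁ c₂ : ℝ → ℝ} {A₁ A₂ B₁ B₂ : ℝ × ℝ → ℝ}
    (hc₁ : ContDiffOn ℝ ∞ c₁ I) (hc₂ : ContDiffOn ℝ ∞ c₂ I)
    (hA₁ : ContDiffOn ℝ ∞ A₁ W) (hA₂ : ContDiffOn ℝ ∞ A₂ W)
    (hB₁ : ContDiffOn ℝ ∞ B₁ W) (hB₂ : ContDiffOn ℝ ∞ B₂ W)
    (h₁ : ∀ x ∈ I, ∀ a ∈ W, relDeriv f (1, 0) (x, a) = c₁ x * A₁ a + c₂ x * B₁ a)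
    (h₂ : ∀ x ∈ I, ∀ a ∈ W, relDeriv f (0, 1) (x, a) = c₁ x * A₂ a + c₂ x * B₂ a)
    (hAB : ∀ a ∈ W, A₁ a * B₂ a - A₂ a * B₁ a ≠ 0)
    {x₀ b : ℝ} (hx₀ : x₀ ∈ I) (hb : b ∈ I) {a₀ : ℝ × ℝ} (ha₀ : a₀ ∈ W)
    (h₁x₀ : c₁ x₀ = 1) (h₂x₀ : c₂ x₀ = 0) (h₁b : c₁ b = 0) (h₂b : c₂ b = 1)
    (hne : ∀ x ∈ I, x ≠ x₀ → c₂ x ≠ 0) :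
    HasNormalFormNear f I W x₀ a₀ := by
  have hcd : ∀ {c : ℝ → ℝ}, ContDiffOn ℝ ∞ c I → ∀ x ∈ I, HasDerivAt c (deriv c x) x :=
    fun h x hx => ((h.contDiffAt (hI.mem_nhds hx)).differentiableAt (by simp)).hasDerivAt
  have hAd : ∀ {A : ℝ × ℝ → ℝ}, ContDiffOn ℝ ∞ A W → ∀ a ∈ W, HasFDerivAt A (fderiv ℝ A a) a :=
    fun h a ha => ((h.contDiffAt (hW.mem_nhds ha)).differentiableAt (by simp)).hasFDerivAt
  have hwr : ∀ x ∈ I, ∀ a ∈ W, _ := fun x hxI a haW =>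
    wronskian_mul_eq_of_relDeriv_eq hI hW hf hx hc₁ hc₂ hA₁ hA₂ hB₁ hB₂ h₁ h₂ hxI haW
  -- the values of the Wronskian at the two base points
  obtain ⟨k, hk⟩ : ∃ k, k = c₁ x₀ * deriv c₂ x₀ - c₂ x₀ * deriv c₁ x₀ := ⟨_, rfl⟩
  obtain ⟨l, hl⟩ : ∃ l, l = c₁ b * deriv c₂ b - c₂ b * deriv c₁ b := ⟨_, rfl⟩
  have hcurlA : ∀ a ∈ W, planarCurl A₁ A₂ a = k * (A₁ a * B₂ a - A₂ a * B₁ a) := by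
    intro a ha
    have h := hwr x₀ hx₀ a ha
    rw [← hk, h₁x₀, h₂x₀] at h
    linear_combination -h
  have hcurlB : ∀ a ∈ W, planarCurl B₁ B₂ a = l * (A₁ a * B₂ a - A₂ a * B₁ a) := by
    intro a ha
    have h := hwr b hb a ha
    rw [← hl, h₁b, h₂b] at h
    linear_combination -h
  have hwr' : ∀ x ∈ I, c₁ x * deriv c₂ x - c₂ x * deriv c₁ x = k * c₁ x + l * c₂ x := by
    intro x hxI
    have h := hwr x hxI a₀ ha₀
    rw [hcurlA a₀ ha₀, hcurlB a₀ ha₀] at h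
    exact mul_right_cancel₀ (hAB a₀ ha₀) (by linear_combination h)
  have hk0 : k ≠ 0 := by
    intro hk0
    obtain ⟨x, hxI, hlt, hzero⟩ := eq_zero_of_wronskian_eq_mul hI hc₁ hc₂ hx₀ (κ := l)
      (by simp [h₁x₀]) h₂x₀ (fun x hxI => by rw [hwr' x hxI, hk0]; ring)
    exact hne x hxI hlt.ne' hzero
  -- the coordinate `t` on the line: `t' = k / w`, where `w` is the Wronskian
  let w : ℝ → ℝ := fun x => k * c₁ x + l * c₂ x
  have hw : ContDiffOn ℝ ∞ w I := (contDiffOn_const.mul hc₁).add (contDiffOn_const.mul hc₂)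
  let I' : Set ℝ := I ∩ w ⁻¹' {0}ᶜ
  have hI' : IsOpen I' := hw.continuousOn.isOpen_inter_preimage hI isOpen_compl_singleton
  have hx₀' : x₀ ∈ I' := ⟨hx₀, by simp [w, h₁x₀, h₂x₀, hk0]⟩
  let t : ℝ → ℝ := fun x => c₂ x / w x
  have ht : ContDiffOn ℝ ∞ t I' := (hc₂.mono inter_subset_left).div (hw.mono inter_subset_left)
    fun x hx => hx.2
  have htd : ∀ x ∈ I', HasDerivAt t (k / w x) x := by
    rintro x ⟨hxI, hxw⟩
    have hxw : w x ≠ 0 := hxw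
    have h := (hcd hc₂ x hxI).div
      (((hcd hc₁ x hxI).const_mul k).add ((hcd hc₂ x hxI).const_mul l)) hxw
    refine h.congr_deriv ?_
    have e := hwr' x hxI
    change _ = w x at e
    change (deriv c₂ x * w x - c₂ x * (k * deriv c₁ x + l * deriv c₂ x)) / w x ^ 2 = k / w x
    rw [div_eq_div_iff (pow_ne_zero 2 hxw) hxw]
    have e' : w x = k * c₁ x + l * c₂ x := rfl
    linear_combination (k * w x) * e + deriv c₂ x * w x * e'
  -- the closed form `k B - l A` gives `log ξ`
  let P₁ : ℝ × ℝ → ℝ := fun a => k * B₁ a - l * A₁ a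
  let P₂ : ℝ × ℝ → ℝ := fun a => k * B₂ a - l * A₂ a
  obtain ⟨u, hu, hud⟩ := exists_potential_of_planarCurl_eq_zero hW hWc (A₁ := P₁) (A₂ := P₂)
    ((contDiffOn_const.mul hB₁).sub (contDiffOn_const.mul hA₁))
    ((contDiffOn_const.mul hB₂).sub (contDiffOn_const.mul hA₂)) (fun a ha => by
      have e₁ : fderiv ℝ P₁ a = _ :=
        (((hAd hB₁ a ha).const_mul k).sub ((hAd hA₁ a ha).const_mul l)).fderiv
      have e₂ : fderiv ℝ P₂ a = _ :=
        (((hAd hB₂ a ha).const_mul k).sub ((hAd hA₂ a ha).const_mul l)).fderiv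
      have hA := hcurlA a ha
      have hB := hcurlB a ha
      rw [planarCurl] at hA hB ⊢
      rw [e₁, e₂]
      simp only [sub_apply, smul_apply, smul_eq_mul]
      linear_combination k * hB - l * hA)
  let ξ : ℝ × ℝ → ℝ := fun a => Real.exp (u a)
  have hξ : ContDiffOn ℝ ∞ ξ W := hu.exp
  have hξ0 : ∀ a, ξ a ≠ 0 := fun a => Real.exp_ne_zero _
  have hξd : ∀ a ∈ W, fderiv ℝ ξ a (1, 0) = ξ a * P₁ a ∧ fderiv ℝ ξ a (0, 1) = ξ a * P₂ a := by
    intro a ha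
    have e : fderiv ℝ ξ a = _ := (hAd hu a ha).exp.fderiv
    rw [e, ← (hud a ha).1, ← (hud a ha).2]
    exact ⟨rfl, rfl⟩
  -- the form `ξ A` is closed and gives `η`
  obtain ⟨η, hη, hηd⟩ := exists_potential_of_planarCurl_eq_zero hW hWc
    (A₁ := fun a => ξ a * A₁ a) (A₂ := fun a => ξ a * A₂ a) (hξ.mul hA₁) (hξ.mul hA₂)
    (fun a ha => by
      have e₁ : fderiv ℝ (fun a => ξ a * A₁ a) a = _ := ((hAd hξ a ha).mul (hAd hA₁ a ha)).fderiv
      have e₂ : fderiv ℝ (fun a => ξ a * A₂ a) a = _ := ((hAd hξ a ha).mul (hAd hA₂ a ha)).fderiv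
      have hA := hcurlA a ha
      rw [planarCurl] at hA ⊢
      rw [e₁, e₂]
      simp only [add_apply, smul_apply, smul_eq_mul]
      rw [(hξd a ha).1, (hξd a ha).2]
      simp only [P₁, P₂]
      linear_combination ξ a * hA)
  -- `F = t ξ + η` has a differential proportional to that of `f`
  let F : ℝ × (ℝ × ℝ) → ℝ := fun q => t q.1 * ξ q.2 + η q.2
  have hU : IsOpen (I' ×ˢ W) := hI'.prod hW
  have hFsm : ContDiffOn ℝ ∞ F (I' ×ˢ W) :=
    ((ht.comp contDiffOn_fst fun q hq => hq.1).mul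
      (hξ.comp contDiffOn_snd fun q hq => hq.2)).add (hη.comp contDiffOn_snd fun q hq => hq.2)
  have hFd : ∀ x ∈ I', ∀ a ∈ W, ∀ s v, fderiv ℝ F (x, a) (s, v) =
      s * (k / w x) * ξ a + (t x * fderiv ℝ ξ a v + fderiv ℝ η a v) := by
    intro x hxI a ha s v
    have g1 := (htd x hxI).comp_hasFDerivAt (x, a) (hasFDerivAt_fst (𝕜 := ℝ) (p := (x, a)))
    have g2 := (hAd hξ a ha).comp (x, a) (hasFDerivAt_snd (𝕜 := ℝ) (p := (x, a)))
    have g3 := (hAd hη a ha).comp (x, a) (hasFDerivAt_snd (𝕜 := ℝ) (p := (x, a)))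
    have e : fderiv ℝ F (x, a) = _ := ((g1.mul g2).add g3).fderiv
    rw [e]
    simp
    ring
  have hfv : ∀ x ∈ I, ∀ a ∈ W, ∀ v : ℝ × ℝ, fderiv ℝ f (x, a) (0, v) =
      fderiv ℝ f (x, a) (1, 0) *
        (v.1 * (c₁ x * A₁ a + c₂ x * B₁ a) + v.2 * (c₁ x * A₂ a + c₂ x * B₂ a)) := by
    intro x hxI a ha v
    have hne := hx (x, a) ⟨hxI, ha⟩
    rw [← h₁ x hxI a ha, ← h₂ x hxI a ha, relDeriv, relDeriv]
    field_simp
    exact ((fderiv ℝ f (x, a)).comp (ContinuousLinearMap.inr ℝ ℝ (ℝ × ℝ))).apply_eq_planar v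
  obtain ⟨χ, hχ, hχ', hev⟩ := exists_eq_comp_of_fderiv_proportional hU
    (hf.mono (prod_mono inter_subset_left subset_rfl)) hFsm
    (fun q hq => hx q ⟨hq.1.1, hq.2⟩)
    (by
      rintro ⟨x, a⟩ ⟨hxI, ha⟩ v
      have hxw : w x ≠ 0 := hxI.2
      have e0 : fderiv ℝ ξ a 0 = 0 := map_zero _
      have e1 : fderiv ℝ η a 0 = 0 := map_zero _
      rw [hFd x hxI a ha, hFd x hxI a ha, hfv x hxI.1 a ha, (fderiv ℝ ξ a).apply_eq_planar v,
        (fderiv ℝ η a).apply_eq_planar v, (hξd a ha).1, (hξd a ha).2, (hηd a ha).1, (hηd a ha).2,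
        e0, e1]
      simp only [P₁, P₂, t]
      field_simp
      simp only [w]
      ring)
    (q₀ := (x₀, a₀)) ⟨hx₀', ha₀⟩
    (by
      rw [hFd x₀ hx₀' a₀ ha₀]
      have hxw : w x₀ ≠ 0 := hx₀'.2
      have e0 : fderiv ℝ ξ a₀ 0 = 0 := map_zero _
      have e1 : fderiv ℝ η a₀ 0 = 0 := map_zero _
      rw [e0, e1]
      simpa using ⟨⟨hk0, hxw⟩, hξ0 a₀⟩)
  obtain ⟨V, hV, V', hV', hVV⟩ := mem_nhds_prod_iff.1 hev
  obtain ⟨V, hVsub, hVo, hxV⟩ := mem_nhds_iff.1 hV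
  obtain ⟨V', hVsub', hVo', haV⟩ := mem_nhds_iff.1 hV'
  obtain ⟨T, hT, hxT, hTsub, hTs⟩ :=
    (ht.mono inter_subset_left).exists_openPartialHomeomorph_real (hI'.inter hVo)
      ⟨hx₀', hxV⟩ (by rw [(htd x₀ hx₀').deriv]; exact div_ne_zero hk0 hx₀'.2)
  obtain ⟨E, hE, haE, hEsub, hEs⟩ :=
    ((hξ.prodMk hη).mono inter_subset_left).exists_openPartialHomeomorph (hW.inter hVo')
      ⟨ha₀, haV⟩ (by
        rw [((hAd hξ a₀ ha₀).prodMk (hAd hη a₀ ha₀)).fderiv]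
        refine ContinuousLinearMap.isInvertible_of_injective fun v hv => ?_
        have g1 : fderiv ℝ ξ a₀ v = 0 := congrArg Prod.fst hv
        have g2 : fderiv ℝ η a₀ v = 0 := congrArg Prod.snd hv
        rw [(fderiv ℝ ξ a₀).apply_eq_planar, (hξd a₀ ha₀).1, (hξd a₀ ha₀).2] at g1
        rw [(fderiv ℝ η a₀).apply_eq_planar, (hηd a₀ ha₀).1, (hηd a₀ ha₀).2] at g2
        have g3 : v.1 * P₁ a₀ + v.2 * P₂ a₀ = 0 :=
          mul_left_cancel₀ (hξ0 a₀) (by linear_combination g1)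
        have g4 : v.1 * A₁ a₀ + v.2 * A₂ a₀ = 0 :=
          mul_left_cancel₀ (hξ0 a₀) (by linear_combination g2)
        have g5 : v.1 * B₁ a₀ + v.2 * B₂ a₀ = 0 := by
          refine mul_left_cancel₀ hk0 ?_
          simp only [P₁, P₂] at g3
          linear_combination g3 + l * g4
        have hne := hAB a₀ ha₀
        refine Prod.ext (mul_right_cancel₀ hne ?_) (mul_right_cancel₀ hne ?_)
        · simp only [Prod.fst_zero]; linear_combination B₂ a₀ * g4 - A₂ a₀ * g5
        · simp only [Prod.snd_zero]; linear_combination A₁ a₀ * g5 - B₁ a₀ * g4)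
  rw [HasNormalFormNear]
  refine ⟨T, E, χ, hTs, hEs, ⟨hχ, hχ'⟩, hxT, haE, fun x hxs a has => ?_⟩
  have hm := hVV (mk_mem_prod (hVsub (hTsub hxs).2) (hVsub' (hEsub has).2))
  refine ⟨(hTsub hxs).1.1, (hEsub has).1, hm.1, ?_⟩
  rw [hT, hE]
  exact hm.2

/-- If any three covectors `relDeriv f · (x, a)` with the same `a` obey a linear relation whose
coefficients do not depend on `a`, then they are combinations of two of them with coefficients
depending on `x` alone; this brings `f` to the normal form. -/
theorem exists_normalForm_of_relations {f : ℝ × (ℝ × ℝ) → ℝ} {I : Set ℝ} {W : Set (ℝ × ℝ)}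
    (hI : IsOpen I) (hW : IsOpen W) (hWc : Convex ℝ W) (hf : ContDiffOn ℝ ∞ f (I ×ˢ W))
    (hx : ∀ q ∈ I ×ˢ W, fderiv ℝ f q (1, 0) ≠ 0)
    (hJ : ∀ x ∈ I, ∀ y ∈ I, x ≠ y → ∀ a ∈ W, relDeriv f (1, 0) (x, a) * relDeriv f (0, 1) (y, a) -
      relDeriv f (0, 1) (x, a) * relDeriv f (1, 0) (y, a) ≠ 0)
    (hrel : ∀ x : Fin 3 → ℝ, (∀ r, x r ∈ I) → Function.Injective x →
      ∀ a : Fin 2 → ℝ × ℝ, (∀ s, a s ∈ W) → Function.Injective a →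
      ∃ m : Fin 3 → ℝ, m ≠ 0 ∧ ∀ s v, ∑ r, m r * relDeriv f v (x r, a s) = 0)
    {x₀ b : ℝ} (hx₀ : x₀ ∈ I) (hb : b ∈ I) (hbx : x₀ ≠ b) {a₀ : ℝ × ℝ} (ha₀ : a₀ ∈ W) :
    HasNormalFormNear f I W x₀ a₀ := by
  have hsm := contDiffOn_relDeriv (hI.prod hW) hf hx
  have hsx : ∀ v, ∀ a ∈ W, ContDiffOn ℝ ∞ (fun x => relDeriv f v (x, a)) I := fun v a ha =>
    (hsm v).comp (by fun_prop) fun x hx => ⟨hx, ha⟩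
  have hsa : ∀ v, ∀ x ∈ I, ContDiffOn ℝ ∞ (fun a => relDeriv f v (x, a)) W := fun v x hx =>
    (hsm v).comp (by fun_prop) fun a ha => ⟨hx, ha⟩
  let J : ℝ → ℝ → ℝ := fun x y => relDeriv f (1, 0) (x, a₀) * relDeriv f (0, 1) (y, a₀) -
    relDeriv f (0, 1) (x, a₀) * relDeriv f (1, 0) (y, a₀)
  have hJb : J x₀ b ≠ 0 := hJ x₀ hx₀ b hb hbx a₀ ha₀
  -- Cramer's rule at `a₀`
  let c₁ : ℝ → ℝ := fun x => J x b / J x₀ b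
  let c₂ : ℝ → ℝ := fun x => J x₀ x / J x₀ b
  have hc₁ : ContDiffOn ℝ ∞ c₁ I := (((hsx _ a₀ ha₀).mul contDiffOn_const).sub
    ((hsx _ a₀ ha₀).mul contDiffOn_const)).div_const _
  have hc₂ : ContDiffOn ℝ ∞ c₂ I := ((contDiffOn_const.mul (hsx _ a₀ ha₀)).sub
    (contDiffOn_const.mul (hsx _ a₀ ha₀))).div_const _
  have h₁x₀ : c₁ x₀ = 1 := div_self hJb
  have h₂x₀ : c₂ x₀ = 0 := by simp [c₂, J, mul_comm]
  have h₁b : c₁ b = 0 := by simp [c₁, J, mul_comm]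
  have h₂b : c₂ b = 1 := div_self hJb
  have hsplit : ∀ x ∈ I, ∀ a ∈ W, ∀ v ∈ ({(1, 0), (0, 1)} : Set (ℝ × ℝ)), relDeriv f v (x, a) =
      c₁ x * relDeriv f v (x₀, a) + c₂ x * relDeriv f v (b, a) := by
    intro x hxI a ha v hv
    rcases eq_or_ne x x₀ with rfl | hxx₀
    · rw [h₁x₀, h₂x₀]; ring
    rcases eq_or_ne x b with rfl | hxb
    · rw [h₁b, h₂b]; ring
    rcases eq_or_ne a a₀ with rfl | haa₀
    · simp only [c₁, c₂]
      field_simp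
      rcases hv with rfl | rfl <;> simp only [J] <;> ring
    have hinj₃ : Function.Injective ![x, x₀, b] := by
      intro r s h
      fin_cases r <;> fin_cases s <;>
        first
          | rfl
          | exact absurd h hxx₀
          | exact absurd h.symm hxx₀
          | exact absurd h hxb
          | exact absurd h.symm hxb
          | exact absurd h hbx
          | exact absurd h.symm hbx
    have hinj₂ : Function.Injective ![a, a₀] := by
      intro r s h
      fin_cases r <;> fin_cases s <;>
        first
          | rfl
          | exact absurd h haa₀
          | exact absurd h.symm haa₀
    obtain ⟨m, hm0, hm⟩ := hrel ![x, x₀, b]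
      (by
        rw [Fin.forall_fin_succ, Fin.forall_fin_two]
        exact ⟨hxI, hx₀, hb⟩) hinj₃ ![a, a₀]
      (by
        rw [Fin.forall_fin_two]
        exact ⟨ha, ha₀⟩) hinj₂
    have k1 := hm 1 (1, 0)
    have k2 := hm 1 (0, 1)
    have k3 := hm 0 v
    simp only [Fin.sum_univ_three, Matrix.cons_val_zero, Matrix.cons_val_one, Matrix.cons_val]
      at k1 k2 k3
    have e1 : m 0 * c₁ x = -m 1 := by
      simp only [c₁]
      field_simp
      simp only [J]
      linear_combination (relDeriv f (0, 1) (b, a₀)) * k1 - (relDeriv f (1, 0) (b, a₀)) * k2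
    have e2 : m 0 * c₂ x = -m 2 := by
      simp only [c₂]
      field_simp
      simp only [J]
      linear_combination (relDeriv f (1, 0) (x₀, a₀)) * k2 - (relDeriv f (0, 1) (x₀, a₀)) * k1
    have hm00 : m 0 ≠ 0 := by
      intro h0
      rw [h0, zero_mul] at e1 e2
      apply hm0
      funext r
      fin_cases r
      · exact h0
      · change m 1 = 0; linarith
      · change m 2 = 0; linarith
    refine mul_left_cancel₀ hm00 ?_
    linear_combination k3 - relDeriv f v (x₀, a) * e1 - relDeriv f v (b, a) * e2
  exact exists_normalForm_of_relDeriv_eq hI hW hWc hf hx hc₁ hc₂ (hsa _ x₀ hx₀) (hsa _ x₀ hx₀)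
    (hsa _ b hb) (hsa _ b hb) (fun x hx a ha => hsplit x hx a ha _ (by simp))
    (fun x hx a ha => hsplit x hx a ha _ (by simp)) (fun a ha => hJ x₀ hx₀ b hb hbx a ha)
    hx₀ hb ha₀ h₁x₀ h₂x₀ h₁b h₂b
    (fun x hxI hne => div_ne_zero (hJ x₀ hx₀ x hxI hne.symm a₀ ha₀) hJb)

/-! ### From the relation between the values to linear relations -/

theorem eventually_injective {n : ℕ} {X : Type*} [TopologicalSpace X] [T2Space X] {x : Fin n → X}
    (hx : Function.Injective x) : ∀ᶠ y in 𝓝 x, Function.Injective y := by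
  have : ∀ᶠ y in 𝓝 x, ∀ i j, i ≠ j → y i ≠ y j := by
    rw [Filter.eventually_all]; intro i
    rw [Filter.eventually_all]; intro j
    rcases eq_or_ne i j with rfl | hij
    · simp
    · filter_upwards [((isOpen_ne_fun (continuous_apply i) (continuous_apply j)).mem_nhds
        (hx.ne hij) : {y : Fin n → X | y i ≠ y j} ∈ 𝓝 x)] with y hy _ using hy
  filter_upwards [this] with y hy i j hij
  by_contra hne
  exact hy i j hne hij

/-- A relation `Φ = 0` with `dΦ ≠ 0` among the six values of `f` yields a linear relation among the
covectors `relDeriv f · (x r, a s)` with the same coefficients for `s = 0` and `s = 1`: with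
`lam r s` the partial derivatives of `Φ`, these are `lam r 0 ∂f/∂x (x r, a 0) =
-lam r 1 ∂f/∂x (x r, a 1)`. -/
theorem exists_relation_of_hypersurface {V : Type*} [NormedAddCommGroup V] [NormedSpace ℝ V]
    {f : ℝ × V → ℝ} {I : Set ℝ} {W : Set V} (hI : IsOpen I) (hW : IsOpen W)
    (hf : ContDiffOn ℝ ∞ f (I ×ˢ W)) (hx : ∀ q ∈ I ×ˢ W, fderiv ℝ f q (1, 0) ≠ 0)
    {Φ : (Fin 3 → Fin 2 → ℝ) → ℝ}
    (hΦd : ∀ x : Fin 3 → ℝ, (∀ r, x r ∈ I) → Function.Injective x →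
      ∀ a : Fin 2 → V, (∀ s, a s ∈ W) → Function.Injective a →
      fderiv ℝ Φ (sixValues f x a) ≠ 0)
    (hΦ : ∀ x : Fin 3 → ℝ, (∀ r, x r ∈ I) → Function.Injective x →
      ∀ a : Fin 2 → V, (∀ s, a s ∈ W) → Function.Injective a → Φ (sixValues f x a) = 0)
    {x : Fin 3 → ℝ} (hxI : ∀ r, x r ∈ I) (hxinj : Function.Injective x)
    {a : Fin 2 → V} (haW : ∀ s, a s ∈ W) (hainj : Function.Injective a) :
    ∃ m : Fin 3 → ℝ, m ≠ 0 ∧ ∀ s v, ∑ r, m r * relDeriv f v (x r, a s) = 0 := by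
  have hd0 := hΦd x hxI hxinj a haW hainj
  have hΦdiff : HasFDerivAt Φ (fderiv ℝ Φ (sixValues f x a)) (sixValues f x a) :=
    (not_imp_comm.1 fderiv_zero_of_not_differentiableAt hd0).hasFDerivAt
  have hfd : ∀ r s, HasFDerivAt f (fderiv ℝ f (x r, a s)) (x r, a s) := fun r s =>
    ((hf.contDiffAt ((hI.prod hW).mem_nhds ⟨hxI r, haW s⟩)).differentiableAt
      (by simp)).hasFDerivAt
  let lam : Fin 3 → Fin 2 → ℝ := fun r s =>
    fderiv ℝ Φ (sixValues f x a) (Pi.single r (Pi.single s 1))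
  have hlam : ∀ y : Fin 3 → Fin 2 → ℝ,
      fderiv ℝ Φ (sixValues f x a) y = ∑ r, ∑ s, y r s * lam r s := by
    intro y
    have hy : y = ∑ r, ∑ s, y r s • (Pi.single r (Pi.single s 1) : Fin 3 → Fin 2 → ℝ) := by
      funext r s
      simp only [Finset.sum_apply, Pi.smul_apply, Pi.single_apply, ite_apply, smul_eq_mul]
      fin_cases s <;> simp
    conv_lhs => rw [hy]
    simp [lam]
  have key : ∀ (h : Fin 3 → ℝ) (k : Fin 2 → V),
      ∑ r, ∑ s, fderiv ℝ f (x r, a s) (h r, k s) * lam r s = 0 := by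
    intro h k
    have hH : HasFDerivAt (fun z : (Fin 3 → ℝ) × (Fin 2 → V) => sixValues f z.1 z.2)
        (ContinuousLinearMap.pi fun r => ContinuousLinearMap.pi fun s =>
          (fderiv ℝ f (x r, a s)).comp
            (((ContinuousLinearMap.proj r).comp (ContinuousLinearMap.fst ℝ _ _)).prod
              ((ContinuousLinearMap.proj s).comp (ContinuousLinearMap.snd ℝ _ _)))) (x, a) := by
      refine hasFDerivAt_pi.2 fun r => hasFDerivAt_pi.2 fun s => ?_
      exact (hfd r s).comp (x, a) (ContinuousLinearMap.hasFDerivAt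
        (((ContinuousLinearMap.proj r).comp (ContinuousLinearMap.fst ℝ (Fin 3 → ℝ) _)).prod
              ((ContinuousLinearMap.proj s).comp (ContinuousLinearMap.snd ℝ _ (Fin 2 → V)))))
    have hcomp := hΦdiff.comp (x, a) hH
    have hzero : (Φ ∘ fun z : (Fin 3 → ℝ) × (Fin 2 → V) => sixValues f z.1 z.2) =ᶠ[𝓝 (x, a)]
        fun _ => 0 := by
      have e1 : ∀ᶠ z : (Fin 3 → ℝ) × (Fin 2 → V) in 𝓝 (x, a), ∀ r, z.1 r ∈ I :=
        Filter.eventually_all.2 fun r => (by fun_prop : Continuous fun z :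
          (Fin 3 → ℝ) × (Fin 2 → V) => z.1 r).continuousAt (hI.mem_nhds (hxI r))
      have e2 : ∀ᶠ z : (Fin 3 → ℝ) × (Fin 2 → V) in 𝓝 (x, a), ∀ s, z.2 s ∈ W :=
        Filter.eventually_all.2 fun s => (by fun_prop : Continuous fun z :
          (Fin 3 → ℝ) × (Fin 2 → V) => z.2 s).continuousAt (hW.mem_nhds (haW s))
      filter_upwards [e1, e2, continuousAt_fst (eventually_injective hxinj),
        continuousAt_snd (eventually_injective hainj)] with z h1 h2 h3 h4
      exact hΦ z.1 h1 h3 z.2 h2 h4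
    have h0 := hcomp.unique ((hasFDerivAt_const (0 : ℝ) (x, a)).congr_of_eventuallyEq hzero)
    have h1 := congrArg (fun L : (Fin 3 → ℝ) × (Fin 2 → V) →L[ℝ] ℝ => L (h, k)) h0
    simp only [ContinuousLinearMap.comp_apply, hlam] at h1
    simpa using h1
  have hrow : ∀ r, fderiv ℝ f (x r, a 0) (1, 0) * lam r 0 +
      fderiv ℝ f (x r, a 1) (1, 0) * lam r 1 = 0 := by
    intro r
    have h := key (Pi.single r 1) 0
    rw [Finset.sum_eq_single r (fun r' _ hr' => by simp [hr', Prod.mk_zero_zero]) (by simp)] at h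
    simpa using h
  have hcol : ∀ s v, ∑ r, fderiv ℝ f (x r, a s) (0, v) * lam r s = 0 := by
    intro s v
    have h := key 0 (Pi.single s v)
    rw [Finset.sum_comm, Finset.sum_eq_single s (fun s' _ hs' => by simp [hs', Prod.mk_zero_zero]) (by simp)] at h
    simpa using h
  have hx' : ∀ r s, fderiv ℝ f (x r, a s) (1, 0) ≠ 0 := fun r s => hx _ ⟨hxI r, haW s⟩
  refine ⟨fun r => lam r 0 * fderiv ℝ f (x r, a 0) (1, 0), fun hm => hd0 ?_, fun s v => ?_⟩
  · have l0 : ∀ r, lam r 0 = 0 := fun r => by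
      simpa [hx' r 0] using congrFun hm r
    have l1 : ∀ r, lam r 1 = 0 := fun r => by
      simpa [l0 r, hx' r 1] using hrow r
    ext y
    rw [hlam]
    simp [Fin.sum_univ_two, l0, l1]
  · have hs : ∀ s r, lam r 0 * fderiv ℝ f (x r, a 0) (1, 0) * relDeriv f v (x r, a s) =
        (if s = 0 then 1 else -1) * (fderiv ℝ f (x r, a s) (0, v) * lam r s) := by
      intro s r
      have := hx' r 0
      have := hx' r 1
      have := hrow r
      fin_cases s
      · simp [relDeriv]; field_simp
      · simp [relDeriv]; field_simp; linear_combination (fderiv ℝ f (x r, a 1) (0, v)) * hrow r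
    simp only [hs, ← Finset.mul_sum, hcol, mul_zero]

/-! ### Manifolds -/

theorem trans_mem_maximalAtlas {E M : Type*} [NormedAddCommGroup E] [NormedSpace ℝ E]
    [TopologicalSpace M] [ChartedSpace E M] [IsManifold 𝓘(ℝ, E) ∞ M]
    {φ : OpenPartialHomeomorph M E} (hφ : φ ∈ atlas E M) {e : OpenPartialHomeomorph E E}
    (he : ContDiffOn ℝ ∞ e e.source ∧ ContDiffOn ℝ ∞ e.symm e.target) :
    φ ≫ₕ e ∈ IsManifold.maximalAtlas 𝓘(ℝ, E) ∞ M := by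
  have heG : e ∈ contDiffGroupoid ∞ 𝓘(ℝ, E) := by
    rw [contDiffGroupoid, mem_groupoid_of_pregroupoid]
    simpa [contDiffPregroupoid] using he
  rw [IsManifold.mem_maximalAtlas_iff]
  intro φ' hφ'
  constructor
  · rw [OpenPartialHomeomorph.trans_symm_eq_symm_trans_symm, OpenPartialHomeomorph.trans_assoc]
    exact (contDiffGroupoid ∞ 𝓘(ℝ, E)).trans ((contDiffGroupoid ∞ 𝓘(ℝ, E)).symm heG)
      ((contDiffGroupoid ∞ 𝓘(ℝ, E)).compatible hφ hφ')
  · rw [← OpenPartialHomeomorph.trans_assoc]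
    exact (contDiffGroupoid ∞ 𝓘(ℝ, E)).trans ((contDiffGroupoid ∞ 𝓘(ℝ, E)).compatible hφ' hφ) heG

section
variable {g : ℝ × (ℝ × ℝ) → ℝ} {x : ℝ} {a : ℝ × ℝ}

theorem partialX_eq_fderiv (hg : DifferentiableAt ℝ g (x, a)) :
    partialX g x a = fderiv ℝ g (x, a) (1, 0) :=
  (hg.hasFDerivAt.comp_hasDerivAt x ((hasDerivAt_id x).prodMk (hasDerivAt_const x a))).deriv

theorem partialXi_eq_fderiv (hg : DifferentiableAt ℝ g (x, a)) :
    partialXi g x a = fderiv ℝ g (x, a) (0, (1, 0)) :=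
  (HasFDerivAt.comp_hasDerivAt a.1 (f := fun t => (x, (t, a.2))) hg.hasFDerivAt
    ((hasDerivAt_const a.1 x).prodMk ((hasDerivAt_id a.1).prodMk (hasDerivAt_const a.1 a.2)))).deriv

theorem partialEta_eq_fderiv (hg : DifferentiableAt ℝ g (x, a)) :
    partialEta g x a = fderiv ℝ g (x, a) (0, (0, 1)) :=
  (HasFDerivAt.comp_hasDerivAt a.2 (f := fun t => (x, (a.1, t))) hg.hasFDerivAt
    ((hasDerivAt_const a.2 x).prodMk ((hasDerivAt_const a.2 a.1).prodMk (hasDerivAt_id a.2)))).deriv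

end

/-- In the charts at `p` and `α`, restricted to a box contained in the domain, the axioms give the
hypotheses of `exists_normalForm_of_relations`; the charts are then composed with the coordinates
found there. -/
theorem IsPSG2S.exists_normalForm {M N : Type*} [TopologicalSpace M] [ChartedSpace ℝ M]
    [IsManifold 𝓘(ℝ, ℝ) ∞ M] [TopologicalSpace N] [ChartedSpace (ℝ × ℝ) N]
    [IsManifold 𝓘(ℝ, ℝ × ℝ) ∞ N] {D : Set (M × N)} {f : M × N → ℝ} (h : IsPSG2S D f)
    {p : M} {α : N} (hp : (p, α) ∈ D) :
    ∃ φ ∈ IsManifold.maximalAtlas 𝓘(ℝ, ℝ) ∞ M,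
    ∃ ψ ∈ IsManifold.maximalAtlas 𝓘(ℝ, ℝ × ℝ) ∞ N,
    ∃ χ : OpenPartialHomeomorph ℝ ℝ,
      ContDiffOn ℝ ∞ χ χ.source ∧ ContDiffOn ℝ ∞ χ.symm χ.target ∧
      p ∈ φ.source ∧ α ∈ ψ.source ∧
      ∀ q ∈ φ.source, ∀ β ∈ ψ.source,
        (q, β) ∈ D ∧ f (q, β) ∈ χ.source ∧
          χ (f (q, β)) = φ q * (ψ β).1 + (ψ β).2 := by
  let φ := chartAt ℝ p
  let ψ := chartAt (ℝ × ℝ) α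
  have hφ : φ ∈ atlas ℝ M := chart_mem_atlas ℝ p
  have hψ : ψ ∈ atlas (ℝ × ℝ) N := chart_mem_atlas (ℝ × ℝ) α
  have hpφ : p ∈ φ.source := mem_chart_source ℝ p
  have hαψ : α ∈ ψ.source := mem_chart_source (ℝ × ℝ) α
  let O : Set (ℝ × (ℝ × ℝ)) := (φ.prod ψ).target ∩ (φ.prod ψ).symm ⁻¹' D
  have hO : IsOpen O := (φ.prod ψ).isOpen_inter_preimage_symm h.isOpen_domain
  have hgO : ContDiffOn ℝ ∞ (coordRep f φ ψ) O := by
    have h1 : ContMDiffOn 𝓘(ℝ, ℝ × (ℝ × ℝ)) 𝓘(ℝ, ℝ) ∞ (fun q : ℝ × (ℝ × ℝ) => φ.symm q.1) O :=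
      (contMDiffOn_chart_symm (I := 𝓘(ℝ, ℝ)) (x := p)).comp
        contDiff_fst.contMDiff.contMDiffOn fun q hq => hq.1.1
    have h2 : ContMDiffOn 𝓘(ℝ, ℝ × (ℝ × ℝ)) 𝓘(ℝ, ℝ × ℝ) ∞
        (fun q : ℝ × (ℝ × ℝ) => ψ.symm q.2) O :=
      (contMDiffOn_chart_symm (I := 𝓘(ℝ, ℝ × ℝ)) (x := α)).comp
        contDiff_snd.contMDiff.contMDiffOn fun q hq => hq.1.2
    exact (h.smooth.comp (h1.prodMk h2) fun q hq => hq.2).contDiffOn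
  have hq₀ : (φ p, ψ α) ∈ O := by
    refine ⟨⟨φ.map_source hpφ, ψ.map_source hαψ⟩, ?_⟩
    change (φ.symm (φ p), ψ.symm (ψ α)) ∈ D
    rwa [φ.left_inv hpφ, ψ.left_inv hαψ]
  obtain ⟨δ, hδ, hball⟩ := Metric.isOpen_iff.1 hO _ hq₀
  rw [← ball_prod_same] at hball
  set I := Metric.ball (φ p) δ
  set W := Metric.ball (ψ α) δ
  have hI : IsOpen I := Metric.isOpen_ball
  have hW : IsOpen W := Metric.isOpen_ball
  have hxI : φ p ∈ I := Metric.mem_ball_self hδ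
  have haW : ψ α ∈ W := Metric.mem_ball_self hδ
  have hIφ : ∀ x ∈ I, x ∈ φ.target := fun x hx => (hball (mk_mem_prod hx haW)).1.1
  have hWψ : ∀ a ∈ W, a ∈ ψ.target := fun a ha => (hball (mk_mem_prod hxI ha)).1.2
  have hD : ∀ x ∈ I, ∀ a ∈ W, (φ.symm x, ψ.symm a) ∈ D := fun x hx a ha =>
    (hball (mk_mem_prod hx ha)).2
  have hg : ContDiffOn ℝ ∞ (coordRep f φ ψ) (I ×ˢ W) := hgO.mono hball
  have hgd : ∀ x ∈ I, ∀ a ∈ W, DifferentiableAt ℝ (coordRep f φ ψ) (x, a) := fun x hx a ha =>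
    (hg.contDiffAt ((hI.prod hW).mem_nhds ⟨hx, ha⟩)).differentiableAt (by simp)
  have hgx : ∀ q ∈ I ×ˢ W, fderiv ℝ (coordRep f φ ψ) q (1, 0) ≠ 0 := by
    rintro ⟨x, a⟩ ⟨hx, ha⟩
    have := h.essential_x φ hφ ψ hψ _ (φ.map_target (hIφ x hx)) _ (ψ.map_target (hWψ a ha))
      (hD x hx a ha)
    rwa [φ.right_inv (hIφ x hx), ψ.right_inv (hWψ a ha), partialX_eq_fderiv (hgd x hx a ha)] at this
  have hgJ : ∀ x ∈ I, ∀ y ∈ I, x ≠ y → ∀ a ∈ W,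
      relDeriv (coordRep f φ ψ) (1, 0) (x, a) * relDeriv (coordRep f φ ψ) (0, 1) (y, a) -
      relDeriv (coordRep f φ ψ) (0, 1) (x, a) * relDeriv (coordRep f φ ψ) (1, 0) (y, a) ≠ 0 := by
    intro x hx y hy hxy a ha
    have := h.essential_xi_eta φ hφ φ hφ ψ hψ _ (φ.map_target (hIφ x hx)) _
      (φ.map_target (hIφ y hy)) _ (ψ.map_target (hWψ a ha))
      (fun he => hxy (φ.symm.injOn (hIφ x hx) (hIφ y hy) he)) (hD x hx a ha) (hD y hy a ha)
    rw [φ.right_inv (hIφ x hx), φ.right_inv (hIφ y hy), ψ.right_inv (hWψ a ha),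
      partialXi_eq_fderiv (hgd x hx a ha), partialEta_eq_fderiv (hgd x hx a ha),
      partialXi_eq_fderiv (hgd y hy a ha), partialEta_eq_fderiv (hgd y hy a ha),
      Matrix.det_fin_two_of] at this
    have h1 := hgx (x, a) ⟨hx, ha⟩
    have h2 := hgx (y, a) ⟨hy, ha⟩
    intro h0
    apply this
    simp only [relDeriv] at h0
    field_simp at h0
    linear_combination h0
  obtain ⟨U, Φ, hΦ⟩ := h.symmetric
  -- three points and two points in the coordinate box give an admissible cortege
  have hcor : ∀ x : Fin 3 → ℝ, (∀ r, x r ∈ I) → Function.Injective x →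
      ∀ a : Fin 2 → ℝ × ℝ, (∀ s, a s ∈ W) → Function.Injective a →
      IsCortege D (fun r => φ.symm (x r)) (fun s => ψ.symm (a s)) :=
    fun x hx hxi a ha hai =>
      ⟨fun r r' he => hxi (φ.symm.injOn (hIφ _ (hx r)) (hIφ _ (hx r')) he),
        fun s s' he => hai (ψ.symm.injOn (hWψ _ (ha s)) (hWψ _ (ha s')) he),
        fun r s => hD _ (hx r) _ (ha s)⟩
  obtain ⟨T, E, χ, hT, hE, hχ, hpT, hαE, hform⟩ := exists_normalForm_of_relations hI hW
    (convex_ball _ _) hg hgx hgJ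
    (fun x hx hxi a ha hai => exists_relation_of_hypersurface hI hW hg hgx (Φ := Φ)
      (fun x hx hxi a ha hai => hΦ.nondegenerate _ (hΦ.mem _ _ (hcor x hx hxi a ha hai))
        (hΦ.relation _ _ (hcor x hx hxi a ha hai)))
      (fun x hx hxi a ha hai => hΦ.relation _ _ (hcor x hx hxi a ha hai)) hx hxi ha hai)
    hxI (b := φ p + δ / 2)
    (by rw [Metric.mem_ball, Real.dist_eq, abs_lt]; constructor <;> linarith)
    (by linarith) haW
  refine ⟨φ ≫ₕ T, trans_mem_maximalAtlas hφ hT, ψ ≫ₕ E, trans_mem_maximalAtlas hψ hE, χ, hχ.1, hχ.2,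
    ?_, ?_, fun q hq β hβ => ?_⟩
  · rw [OpenPartialHomeomorph.trans_source]; exact ⟨hpφ, hpT⟩
  · rw [OpenPartialHomeomorph.trans_source]; exact ⟨hαψ, hαE⟩
  · rw [OpenPartialHomeomorph.trans_source] at hq hβ
    obtain ⟨hx, ha, hs, he⟩ := hform (φ q) hq.2 (ψ β) hβ.2
    have hmem := hD _ hx _ ha
    simp only [coordRep, φ.left_inv hq.1, ψ.left_inv hβ.1] at hmem hs he
    exact ⟨hmem, hs, he⟩

theorem mainTheorem1 :
    -- every such geometry has, near each point of its domain, the canonical form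
    (∀ (M : Type*) (N : Type*) [TopologicalSpace M] [ChartedSpace ℝ M] [IsManifold 𝓘(ℝ, ℝ) ∞ M]
        [TopologicalSpace N] [ChartedSpace (ℝ × ℝ) N] [IsManifold 𝓘(ℝ, ℝ × ℝ) ∞ N]
        (D : Set (M × N)) (f : M × N → ℝ), IsPSG2S D f →
      ∀ (p : M) (α : N), (p, α) ∈ D →
        ∃ φ ∈ IsManifold.maximalAtlas 𝓘(ℝ, ℝ) ∞ M,
        ∃ ψ ∈ IsManifold.maximalAtlas 𝓘(ℝ, ℝ × ℝ) ∞ N,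
        ∃ χ : OpenPartialHomeomorph ℝ ℝ,
          ContDiffOn ℝ ∞ χ χ.source ∧ ContDiffOn ℝ ∞ χ.symm χ.target ∧
          p ∈ φ.source ∧ α ∈ ψ.source ∧
          ∀ q ∈ φ.source, ∀ β ∈ ψ.source,
            (q, β) ∈ D ∧ f (q, β) ∈ χ.source ∧
              χ (f (q, β)) = φ q * (ψ β).1 + (ψ β).2) ∧
    -- the canonical form gives such a geometry
    IsPSG2S canonicalDomain canonicalMetric ∧
    -- the rank of its functional matrix is 5
    (∀ (x : Fin 3 → ℝ) (a : Fin 2 → ℝ × ℝ), (∃ r r', x r ≠ x r') →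
      (∀ s, (a s).1 ≠ 0) → (functionalMatrix canonicalMetric x a).rank = 5) ∧
    -- the hypersurface is given by the vanishing of the determinant, which is the only relation
    LiesOnHypersurface canonicalDomain canonicalMetric
      {y | fderiv ℝ canonicalRelation y ≠ 0} canonicalRelation ∧
    {y | ∃ x a, IsCortege canonicalDomain x a ∧ y = sixValues canonicalMetric x a} =
      {y | canonicalRelation y = 0 ∧ Function.Injective (fun r => y r 0) ∧
        Function.Injective (fun r => y r 1) ∧ ∃ r, y r 0 ≠ y r 1} :=
  ⟨fun _ _ _ _ _ _ _ _ _ _ h _ _ hp => h.exists_normalForm hp, isPSG2S_canonical,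
    rank_functionalMatrix_canonical, liesOnHypersurface_canonical, setOf_sixValues_canonical⟩
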